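/- Let $R$ be a unital ring. A $\mathbb{Z}\times\mathbb{Z}$-bigraded exact couple of $R$-modules with bidegrees $a,b,c\in\mathbb{Z}\times\mathbb{Z}$ consists of $R$-modules $D_x$, $E_x$ ($x\in\mathbb{Z}\times\mathbb{Z}$) and $R$-linear maps $i\colon D_x\to D_{x+a}$, $j\colon D_x\to E_{x+b}$, $k\colon E_x\to D_{x+c}$ such that $D\xrightarrow{i}D\xrightarrow{j}E\xrightarrow{k}D\xrightarrow{i}D$ is exact everywhere. It is *regular* if $\sigma:=\det[a\ \ b+c]\in\{1,-1\}$. A morphism of exact couples with the same bidegrees is a pair of families of linear maps $D_x\to D'_x$, $E_x\to E'_x$ that commute with $i,j,k$. Fix a regular choice of $a,b,c$. *Abutments.* For $n\in\mathbb{Z}$ let $D(n)$ be the $\mathbb{Z}$-diagram $\cdots\to D_{x(n)-a}\xrightarrow{i}D_{x(n)}\xrightarrow{i}D_{x(n)+a}\to\cdots$ with $x(n)=\sigma n(b+c)$. It contains exactly the $D_x$ with $\det[a\ \ x]=n$. Put $L_n=\operatorname{colim}D(n)$ and $L^n=\lim D(n)$. For $\det[a\ \ x]=n$ let $\pi_x\colon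 D_x\to L_n$ and $\rho^x\colon L^n\to D_x$ be the canonical maps, and put $L_x=\operatorname{Im}\pi_x$, $L^x=\operatorname{Ker}\rho^x$. Then $L_{x-a}\subseteq L_x$ and $L^x\subseteq L^{x+a}$. *Stable $E$-objects.* By recursion on ordinals $\tau$ let $I^0_x=D_x$, $I^{\tau+1}_x=i(I^\tau_{x-a})$, $I^\tau_x=\bigcap_{\rho<\tau}I^\rho_x$ for limit $\tau$; and let $N^0_x=0$, $N^{\tau+1}_x=i^{-1}(N^\tau_{x+a})$, $N^\tau_x=\bigcup_{\rho<\tau}N^\rho_x$ for limit $\tau$. Put $Z^\tau_y=k^{-1}(I^\tau_{y+c})$ and $B^\tau_y=j(N^\tau_{y-b})$. The objects $Z^\tau/B^\tau$ are stable from $\alpha$ on if $Z^\tau_y=Z^\alpha_y$ and $B^\tau_y=B^\alpha_y$ for all $\tau\ge\alpha$ and all $y$; in that case put $\bar E_y=Z^\alpha_y/B^\alpha_y$, which does not depend on $\alpha$. *Spectral sequence.* For finite $r\ge 0$ the pages $E^{r+1}_y=Z^r_y/B^r_y$ with $Z^r=k^{-1}(\operatorname{Im}i^r)$, $B^r=j(\operatorname{Ker}i^r)$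 form a spectral sequence whose differential $d^{r+1}$, of bidegree $b+c-ra$, sends the class of $e$ to the class of $j(s)$ for any $s$ with $i^r(s)=k(e)$. Its limit page is $E^\infty_y=Z^\infty_y/B^\infty_y$ with $Z^\infty=\bigcap_r Z^r$ and $B^\infty=\bigcup_r B^r$, the infinite cycles and boundaries of the spectral sequence in $E^1=E$. **Theorem (E-infinity extension theorem).** For every such regular exact couple there is an ordinal from which on the objects $Z^\tau/B^\tau$ are stable, so that $\bar E$ is defined. For every $x\in\mathbb{Z}\times\mathbb{Z}$, with $w:=x+b+c$, one has $Z\subseteq Z^\infty$ for the stable cycles $Z$ and $\operatorname{Im}j_x=\operatorname{Ker}k_{x+b}\subseteq Z^\infty_{x+b}$, and there is a morphism of short exact sequences $$\begin{array}{ccccccccc} 0\to & L_x/L_{x-a} & \to & \bar E_{x+b} & \to & L^{w+a}/L^{w} & \to 0\\ & \| & & \downarrow & & \downarrow{\scriptstyle M} & \\ 0\to & L_x/L_{x-a} & \to & E^\infty_{x+b} & \to & Z^\infty_{x+b}/\operatorname{Im}j_x & \to 0 \end{array}$$ in which the middle and the right vertical maps are injective and the right-hand square is a pullback. The map $\bar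 E_{x+b}\to E^\infty_{x+b}$ is induced by the inclusion of the stable cycles in $Z^\infty_{x+b}$; in the bottom row the first map sends the class of $\pi_x(s)$ to the class of $j(s)$, and the second is the canonical projection. Furthermore, there is a 5-term exact sequence $$0\to L^{w}\hookrightarrow L^{w+a}\xrightarrow{\ t\ }Z^\infty_{x+b}/\operatorname{Im}j_x\xrightarrow{\ \delta\ }{\lim_r}^1\operatorname{Ker}\bigl(i^r\colon D_{w-ra}\to D_w\bigr)\to{\lim_r}^1\operatorname{Ker}\bigl(i^{r+1}\colon D_{w-ra}\to D_{w+a}\bigr),$$ where $t(s)$ is the class of any $z\in Z^\infty_{x+b}$ with $k(z)=\rho^w(s)$, the last map is induced by the inclusions $\operatorname{Ker}i^r\subseteq\operatorname{Ker}i^{r+1}$, and $\delta$ is the connecting homomorphism: if $y_r\in\operatorname{Ker}(i^{r+1}\colon D_{w-ra}\to D_{w+a})$ satisfy $i^r(y_r)=k(z)$ for all $r\ge0$, then $\delta$ sends the class of $z$ to the class of $(y_r-i(y_{r+1}))_{r\ge 0}$. The map $M$ is the monomorphism in the image factorization of $t$: $t$ is the projection $L^{w+a}\to L^{w+a}/L^w$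 followed by $M$. Both diagrams depend functorially on morphisms of exact couples: a morphism of exact couples induces maps of all objects in the two diagrams which commute with all maps in the two diagrams, and this is compatible with identities and composition. -/

import Mathlib

universe u v

noncomputable section

/-! ### Diagrams indexed by the ordered set of integers -/

/-- A `ℤ`-diagram of `R`-modules: a functor from the poset `ℤ` to `R`-modules. -/
structure ZDiagram (R : Type u) [Ring R] where
  obj : ℤ → Type v
  [addCommGroup : ∀ p, AddCommGroup (obj p)]
  [module : ∀ p, Module R (obj p)]
  map : ∀ p q, p ≤ q → obj p →ₗ[R] obj q
  map_self : ∀ p (s : obj p), map p p le_rfl s = s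
  map_map : ∀ p q r (hpq : p ≤ q) (hqr : q ≤ r) (s : obj p),
    map q r hqr (map p q hpq s) = map p r (hpq.trans hqr) s

namespace ZDiagram

attribute [instance] ZDiagram.addCommGroup ZDiagram.module

variable {R : Type u} [Ring R]

/-- A morphism of `ℤ`-diagrams. -/
structure Hom (A B : ZDiagram.{u, v} R) where
  app : ∀ p, A.obj p →ₗ[R] B.obj p
  naturality : ∀ p q (h : p ≤ q) (s : A.obj p), app q (A.map p q h s) = B.map p q h (app p s)

variable (A : ZDiagram.{u, v} R)

/-- The colimit of a `ℤ`-diagram. -/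
abbrev colim : Type v := Module.DirectLimit A.obj A.map

/-- The cocone map into the colimit. -/
abbrev toColim (p : ℤ) : A.obj p →ₗ[R] A.colim := Module.DirectLimit.of R ℤ A.obj A.map p

/-- The map `∏ Aₙ → ∏ Aₙ` whose `q`-th coordinate is `s ↦ s_q - a_{q-1}(s_{q-1})`. -/
def limDiff : (∀ p, A.obj p) →ₗ[R] (∀ p, A.obj p) :=
  LinearMap.pi fun q =>
    LinearMap.proj q - A.map (q - 1) q (by omega) ∘ₗ LinearMap.proj (q - 1)

/-- The limit of a `ℤ`-diagram. -/
def lim : Submodule R (∀ p, A.obj p) := LinearMap.ker A.limDiff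

instance : AddCommGroup A.lim := Submodule.addCommGroup A.lim

/-- The cone map out of the limit. -/
def ofLim (p : ℤ) : A.lim →ₗ[R] A.obj p := LinearMap.proj p ∘ₗ A.lim.subtype

/-- The derived limit `lim¹` of a `ℤ`-diagram. -/
abbrev lim1 : Type v := (∀ p, A.obj p) ⧸ LinearMap.range A.limDiff

variable {A}

/-- The map of `lim¹`-modules induced by a morphism of `ℤ`-diagrams. -/
def Hom.lim1Map {B : ZDiagram.{u, v} R} (f : Hom A B) : A.lim1 →ₗ[R] B.lim1 :=
  Submodule.mapQ _ _ (LinearMap.pi fun p => f.app p ∘ₗ LinearMap.proj p) (by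
    rintro _ ⟨s, rfl⟩
    refine ⟨fun p => f.app p (s p), ?_⟩
    funext q
    simp [limDiff, f.naturality])

variable (A)

/-- The pointwise kernel diagram `K^q A`: in position `p ≤ q` it is `Ker (A_p → A_q)`, and it
vanishes in positions `p ≥ q` (it is `Ker (A_p → A_p)` there). -/
def kernelDiagram (q : ℤ) : ZDiagram.{u, v} R where
  obj p := LinearMap.ker (A.map p (max p q) (le_max_left p q))
  map p p' h := (A.map p p' h).restrict (by
    intro s hs
    rw [LinearMap.mem_ker] at hs ⊢
    rw [A.map_map, ← A.map_map p (max p q) (max p' q) (le_max_left p q)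
      (max_le_max_right q h), hs, map_zero])
  map_self p s := Subtype.ext (A.map_self p s)
  map_map p p' p'' h h' s := Subtype.ext (A.map_map p p' p'' h h' s)

/-- The inclusion `K^q A → K^{q'} A` for `q ≤ q'`. -/
def kernelInclusion (q q' : ℤ) (h : q ≤ q') : Hom (A.kernelDiagram q) (A.kernelDiagram q') where
  app p := Submodule.inclusion (by
    intro s hs
    rw [LinearMap.mem_ker] at hs ⊢
    rw [← A.map_map p (max p q) (max p q') (le_max_left p q) (max_le_max_left p h), hs, map_zero])
  naturality _ _ _ _ := rfl

variable {A}

/-- The morphism of pointwise kernel diagrams induced by a morphism of `ℤ`-diagrams. -/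
def Hom.kernelMap {B : ZDiagram.{u, v} R} (f : Hom A B) (q : ℤ) :
    Hom (A.kernelDiagram q) (B.kernelDiagram q) where
  app p := (f.app p).restrict (by
    intro s hs
    rw [LinearMap.mem_ker] at hs ⊢
    rw [← f.naturality, hs, map_zero])
  naturality p p' h s := Subtype.ext (f.naturality p p' h s.1)

end ZDiagram

/-! ### Spectral sequences -/

/-- A `ℤ × ℤ`-bigraded spectral sequence of `R`-modules which starts on page `1`. Here `page r` is
the page `E^{r+1}`, and `v r` is the bidegree of its differential `d^{r+1}`. A map of bidegree `t`
is given by its components from position `x` to position `y`, whenever `x + t = y`. -/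
structure BigradedSpectralSequence (R : Type u) [Ring R] (v : ℕ → ℤ × ℤ) where
  page : ℕ → ℤ × ℤ → Type v
  [addCommGroup : ∀ r x, AddCommGroup (page r x)]
  [module : ∀ r x, Module R (page r x)]
  d : ∀ r x y, x + v r = y → page r x →ₗ[R] page r y
  d_comp_d : ∀ r x y z (h : x + v r = y) (h' : y + v r = z), d r y z h' ∘ₗ d r x y h = 0
  homologyIso : ∀ r x, page (r + 1) x ≃ₗ[R]
    (LinearMap.ker (d r x (x + v r) rfl) ⧸
      (LinearMap.range (d r (x - v r) x (sub_add_cancel x (v r)))).submoduleOf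
        (LinearMap.ker (d r x (x + v r) rfl)))

namespace BigradedSpectralSequence

attribute [instance] BigradedSpectralSequence.addCommGroup BigradedSpectralSequence.module

variable {R : Type u} [Ring R] {v : ℕ → ℤ × ℤ} (S : BigradedSpectralSequence R v)

/-- The submodule `Z^r ⊆ E^1` together with the projection `τ^r : Z^r → E^{r+1}`, by recursion:
`Z^0 = E^1`, `τ^0 = id`, and `Z^{r+1} = (τ^r)⁻¹ Ker d^{r+1}`, while `τ^{r+1}` sends `e` to the
homology class of `τ^r e`. -/
def cyclesAux (x : ℤ × ℤ) : (r : ℕ) → (Z : Submodule R (S.page 0 x)) × (Z →ₗ[R] S.page r x)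
  | 0 => ⟨⊤, Submodule.subtype ⊤⟩
  | r + 1 =>
    let Z := (cyclesAux x r).1
    let τ := (cyclesAux x r).2
    let K := LinearMap.ker (S.d r x (x + v r) rfl)
    ⟨(K.comap τ).map Z.subtype,
      (S.homologyIso r x).symm.toLinearMap ∘ₗ Submodule.mkQ _ ∘ₗ
        (τ.restrict (p := K.comap τ) (q := K) fun _ h => h) ∘ₗ
        (Submodule.equivMapOfInjective Z.subtype Z.injective_subtype (K.comap τ)).symm.toLinearMap⟩

/-- The `r`-th cycles `Z^r ⊆ E^1`. -/
def cycles (r : ℕ) (x : ℤ × ℤ) : Submodule R (S.page 0 x) := (S.cyclesAux x r).1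

/-- The projection `τ^r : Z^r → E^{r+1}`. -/
def toPage (r : ℕ) (x : ℤ × ℤ) : S.cycles r x →ₗ[R] S.page r x := (S.cyclesAux x r).2

/-- The `r`-th boundaries `B^r ⊆ E^1`: the kernel of `τ^r : Z^r → E^{r+1}`, so that
`B^0 = 0` and `B^{r+1} = (τ^r)⁻¹ Im d^{r+1}`. -/
def boundaries (r : ℕ) (x : ℤ × ℤ) : Submodule R (S.page 0 x) :=
  (LinearMap.ker (S.toPage r x)).map (S.cycles r x).subtype

/-- `Z^∞ = ⋂ Z^r`. -/
def cyclesInf (x : ℤ × ℤ) : Submodule R (S.page 0 x) := ⨅ r, S.cycles r x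

/-- `B^∞ = ⋃ B^r` (an increasing union). -/
def boundariesInf (x : ℤ × ℤ) : Submodule R (S.page 0 x) := ⨆ r, S.boundaries r x

end BigradedSpectralSequence

/-! ### Exact couples -/

/-- The determinant of the matrix with columns `x`, `y`. -/
def det₂ (x y : ℤ × ℤ) : ℤ := x.1 * y.2 - y.1 * x.2

/-- The bidegrees of the structure maps `i`, `j`, `k` of an exact couple. -/
structure Bidegrees where
  a : ℤ × ℤ
  b : ℤ × ℤ
  c : ℤ × ℤ

namespace Bidegrees

variable (β : Bidegrees)

/-- `σ = det [a, b + c]`. -/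
def σ : ℤ := det₂ β.a (β.b + β.c)

/-- Regularity: `σ ∈ {1, -1}`. -/
def Regular : Prop := β.σ = 1 ∨ β.σ = -1

/-- The position `x(n) = σ n (b + c)`. -/
def basePoint (n : ℤ) : ℤ × ℤ := (β.σ * n) • (β.b + β.c)

/-- The integer `r` with `x = x(n) + r a` where `n = det [a, x]`. -/
def pos (x : ℤ × ℤ) : ℤ := β.σ * det₂ x (β.b + β.c)

variable {β}

theorem basePoint_add_pos (hβ : β.Regular) (n : ℤ) (x : ℤ × ℤ) (hx : det₂ β.a x = n) :
    β.basePoint n + β.pos x • β.a = x := by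
  have hσ : β.σ * β.σ = 1 := by rcases hβ with h | h <;> simp [h]
  subst hx
  obtain ⟨⟨a1, a2⟩, ⟨b1, b2⟩, ⟨c1, c2⟩⟩ := β
  obtain ⟨x1, x2⟩ := x
  have h : ∀ s : ℤ, s = a1 * (b2 + c2) - (b1 + c1) * a2 → s * s = 1 →
      s * (a1 * x2 - x1 * a2) * (b1 + c1) + s * (x1 * (b2 + c2) - (b1 + c1) * x2) * a1 = x1 ∧
      s * (a1 * x2 - x1 * a2) * (b2 + c2) + s * (x1 * (b2 + c2) - (b1 + c1) * x2) * a2 = x2 := by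
    intro s hs h1
    constructor
    · linear_combination x1 * h1 - s * x1 * hs
    · linear_combination x2 * h1 - s * x2 * hs
  obtain ⟨h1, h2⟩ := h _ rfl hσ
  exact Prod.ext h1 h2

theorem det_sub (x : ℤ × ℤ) : det₂ β.a (x - β.a) = det₂ β.a x := by
  simp only [det₂, Prod.fst_sub, Prod.snd_sub]; ring

theorem det_add (x : ℤ × ℤ) : det₂ β.a (x + β.a) = det₂ β.a x := by
  simp only [det₂, Prod.fst_add, Prod.snd_add]; ring

end Bidegrees

/-- A `ℤ × ℤ`-bigraded exact couple of `R`-modules whose structure maps have the given bidegrees.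
A map of bidegree `t` is given by its components from position `x` to position `y`, whenever
`x + t = y`. -/
structure ExactCouple (R : Type u) [Ring R] (β : Bidegrees) where
  D : ℤ × ℤ → Type v
  E : ℤ × ℤ → Type v
  [addCommGroupD : ∀ x, AddCommGroup (D x)]
  [moduleD : ∀ x, Module R (D x)]
  [addCommGroupE : ∀ x, AddCommGroup (E x)]
  [moduleE : ∀ x, Module R (E x)]
  i : ∀ x y, x + β.a = y → D x →ₗ[R] D y
  j : ∀ x y, x + β.b = y → D x →ₗ[R] E y
  k : ∀ x y, x + β.c = y → E x →ₗ[R] D y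
  exact_ij : ∀ x y z (h : x + β.a = y) (h' : y + β.b = z), Function.Exact (i x y h) (j y z h')
  exact_jk : ∀ x y z (h : x + β.b = y) (h' : y + β.c = z), Function.Exact (j x y h) (k y z h')
  exact_ki : ∀ x y z (h : x + β.c = y) (h' : y + β.a = z), Function.Exact (k x y h) (i y z h')

namespace ExactCouple

attribute [instance] ExactCouple.addCommGroupD ExactCouple.moduleD ExactCouple.addCommGroupE
  ExactCouple.moduleE

variable {R : Type u} [Ring R] {β : Bidegrees}

/-- A morphism of exact couples. -/
structure Hom (C C' : ExactCouple.{u, v} R β) where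
  f : ∀ x, C.D x →ₗ[R] C'.D x
  g : ∀ x, C.E x →ₗ[R] C'.E x
  comm_i : ∀ x y (h : x + β.a = y) (s : C.D x), f y (C.i x y h s) = C'.i x y h (f x s)
  comm_j : ∀ x y (h : x + β.b = y) (s : C.D x), g y (C.j x y h s) = C'.j x y h (f x s)
  comm_k : ∀ x y (h : x + β.c = y) (s : C.E x), f y (C.k x y h s) = C'.k x y h (g x s)

/-- The identity morphism. -/
def Hom.id (C : ExactCouple.{u, v} R β) : Hom C C where
  f _ := LinearMap.id
  g _ := LinearMap.id
  comm_i _ _ _ _ := rfl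
  comm_j _ _ _ _ := rfl
  comm_k _ _ _ _ := rfl

/-- The composite `C → C' → C''`. -/
def Hom.comp {C C' C'' : ExactCouple.{u, v} R β} (φ : Hom C C') (ψ : Hom C' C'') :
    Hom C C'' where
  f x := ψ.f x ∘ₗ φ.f x
  g x := ψ.g x ∘ₗ φ.g x
  comm_i x y h s := by simp [φ.comm_i, ψ.comm_i]
  comm_j x y h s := by simp [φ.comm_j, ψ.comm_j]
  comm_k x y h s := by simp [φ.comm_k, ψ.comm_k]

variable (C : ExactCouple.{u, v} R β)

/-- The identification `D x = D y` for `x = y`. -/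
def transport {x y : ℤ × ℤ} (h : x = y) : C.D x →ₗ[R] C.D y := h ▸ LinearMap.id

/-- The iterate `i^r : D x → D (x + r a)`. -/
def iter : (r : ℕ) → (x y : ℤ × ℤ) → x + r • β.a = y → C.D x →ₗ[R] C.D y
  | 0, _, _, h => C.transport (by simpa using h)
  | r + 1, x, y, h =>
    iter r (x + β.a) y (by rw [← h, add_assoc, succ_nsmul']) ∘ₗ C.i x (x + β.a) rfl

theorem iter_zero (r : ℕ) (hr : r = 0) (x : ℤ × ℤ) (h : x + r • β.a = x) (s : C.D x) :
    C.iter r x x h s = s := by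
  subst hr; rfl

theorem iter_iter (r s t : ℕ) (x y z : ℤ × ℤ) (h : x + r • β.a = y) (h' : y + s • β.a = z)
    (h'' : x + t • β.a = z) (ht : r + s = t) (e : C.D x) :
    C.iter s y z h' (C.iter r x y h e) = C.iter t x z h'' e := by
  subst ht
  induction r generalizing x with
  | zero =>
    obtain rfl : x = y := by simpa using h
    obtain ⟨t, ht⟩ : ∃ t, t = 0 + s := ⟨_, rfl⟩
    have : ∀ t (ht : t = s) (h'' : x + t • β.a = z),
        C.iter s x z h' (C.iter 0 x x h e) = C.iter t x z h'' e := by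
      intro t ht h''; subst ht; rfl
    exact this _ (Nat.zero_add s) h''
  | succ r ih =>
    have key : ∀ t (ht : t = (r + s) + 1) (h'' : x + t • β.a = z),
        C.iter s y z h' (C.iter (r + 1) x y h e) = C.iter t x z h'' e := by
      intro t ht h''
      subst ht
      exact ih (x + β.a) (by rw [← h, add_assoc, succ_nsmul']) (C.i x (x + β.a) rfl e)
        (by rw [← h'', add_assoc, succ_nsmul'])
    exact key _ (by omega) h''

theorem hom_iter {C C' : ExactCouple.{u, v} R β} (φ : Hom C C') (r : ℕ) (x y : ℤ × ℤ)
    (h : x + r • β.a = y) (s : C.D x) :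
    φ.f y (C.iter r x y h s) = C'.iter r x y h (φ.f x s) := by
  induction r generalizing x with
  | zero =>
    obtain rfl : x = y := by simpa using h
    rfl
  | succ r ih =>
    change φ.f y (C.iter r (x + β.a) y _ _) = C'.iter r (x + β.a) y _ _
    rw [ih, φ.comm_i]

theorem column_aux (x : ℤ × ℤ) (p q : ℤ) (h : p ≤ q) :
    x + p • β.a + (q - p).toNat • β.a = x + q • β.a := by
  rw [← natCast_zsmul, Int.toNat_of_nonneg (by omega), add_assoc, ← add_zsmul]
  congr 2; omega

/-- The `ℤ`-diagram `⋯ → D (x - a) → D x → D (x + a) → ⋯`, with `D (x + p a)` in position `p`. -/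
def column (x : ℤ × ℤ) : ZDiagram.{u, v} R where
  obj p := C.D (x + p • β.a)
  map p q h := C.iter (q - p).toNat _ _ (column_aux x p q h)
  map_self p s := C.iter_zero _ (by simp) _ _ s
  map_map p q r h h' s := C.iter_iter _ _ _ _ _ _ _ _ _ (by omega) s

/-- The morphism of `ℤ`-diagrams induced by a morphism of exact couples. -/
def Hom.column {C C' : ExactCouple.{u, v} R β} (φ : Hom C C') (x : ℤ × ℤ) :
    ZDiagram.Hom (C.column x) (C'.column x) where
  app _ := φ.f _
  naturality _ _ _ s := hom_iter φ _ _ _ _ s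

/-! #### Universal abutments and their filtrations -/

/-- The `ℤ`-diagram `D(n)`. -/
def diagram (n : ℤ) : ZDiagram.{u, v} R := C.column (β.basePoint n)

variable (hβ : β.Regular)

/-- The cocone map `π_x : D x → L_n` into the colimit abutment `L_n = colim D(n)`, for
`n = det [a, x]`. -/
def colimMap (n : ℤ) (x : ℤ × ℤ) (hx : det₂ β.a x = n) : C.D x →ₗ[R] (C.diagram n).colim :=
  (C.diagram n).toColim (β.pos x) ∘ₗ C.transport (β.basePoint_add_pos hβ n x hx).symm

/-- The cone map `ρ^x : L^n → D x` out of the limit abutment `L^n = lim D(n)`, for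
`n = det [a, x]`. -/
def limMap (n : ℤ) (x : ℤ × ℤ) (hx : det₂ β.a x = n) : (C.diagram n).lim →ₗ[R] C.D x :=
  C.transport (β.basePoint_add_pos hβ n x hx) ∘ₗ (C.diagram n).ofLim (β.pos x)

/-- The filtration stage `L_x = Im π_x` of the colimit abutment. -/
def colimFiltration (n : ℤ) (x : ℤ × ℤ) (hx : det₂ β.a x = n) :
    Submodule R (C.diagram n).colim :=
  LinearMap.range (C.colimMap hβ n x hx)

/-- The filtration stage `L^x = Ker ρ^x` of the limit abutment. -/
def limFiltration (n : ℤ) (x : ℤ × ℤ) (hx : det₂ β.a x = n) : Submodule R (C.diagram n).lim :=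
  LinearMap.ker (C.limMap hβ n x hx)

/-- `L_x`, as a submodule of `L_n` with `n = det [a, x]`. -/
abbrev colimStage (x : ℤ × ℤ) : Submodule R (C.diagram (det₂ β.a x)).colim :=
  C.colimFiltration hβ (det₂ β.a x) x rfl

/-- `L_{x - a}`, as a submodule of `L_n` with `n = det [a, x]`. -/
abbrev colimStagePrev (x : ℤ × ℤ) : Submodule R (C.diagram (det₂ β.a x)).colim :=
  C.colimFiltration hβ (det₂ β.a x) (x - β.a) (β.det_sub x)

/-- The adjacent filtration quotient `L_x / L_{x - a}` of the colimit abutment. -/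
abbrev colimQuot (x : ℤ × ℤ) : Type v :=
  C.colimStage hβ x ⧸ (C.colimStagePrev hβ x).submoduleOf (C.colimStage hβ x)

/-- `L^w`, as a submodule of `L^m` with `m = det [a, w]`. -/
abbrev limStage (w : ℤ × ℤ) : Submodule R (C.diagram (det₂ β.a w)).lim :=
  C.limFiltration hβ (det₂ β.a w) w rfl

/-- `L^{w + a}`, as a submodule of `L^m` with `m = det [a, w]`. -/
abbrev limStageNext (w : ℤ × ℤ) : Submodule R (C.diagram (det₂ β.a w)).lim :=
  C.limFiltration hβ (det₂ β.a w) (w + β.a) (β.det_add w)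

/-- The adjacent filtration quotient `L^{w + a} / L^w` of the limit abutment. -/
abbrev limQuot (w : ℤ × ℤ) : Type v :=
  C.limStageNext hβ w ⧸ (C.limStage hβ w).submoduleOf (C.limStageNext hβ w)

/-! #### Transfinite cycles and boundaries, and the stable `E`-objects -/

/-- The iterated image subobject `I^τ_x ⊆ D x`: `I^0 = D`, the stage `I^{τ+1}_x` is the image under
`i` of `I^τ_{x-a}`, and `I^τ` is the limit (intersection) of the earlier stages at limit ordinals. -/
def imageSub (τ : Ordinal.{v}) : (x : ℤ × ℤ) → Submodule R (C.D x) :=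
  Ordinal.limitRecOn τ (fun _ => ⊤)
    (fun _ I x => (I (x - β.a)).map (C.i (x - β.a) x (sub_add_cancel x β.a)))
    (fun τ _ I x => ⨅ (ρ : Ordinal.{v}) (h : ρ < τ), I ρ h x)

/-- The kernel of the projection `D x → Q^τ_x` onto the iterated image quotient. Here `Q^0 = D`, so
its kernel is `0`; as `Q^{τ+1}_x` is the image of `Q^τ_x → Q^τ_{x+a}`, the kernel of
`D x → Q^{τ+1}_x` is the preimage under `i` of the kernel of `D (x+a) → Q^τ_{x+a}`; and at a limit
ordinal `Q^τ` is the colimit of the earlier quotients, whose kernel is the increasing union of the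
earlier kernels. -/
def quotKer (τ : Ordinal.{v}) : (x : ℤ × ℤ) → Submodule R (C.D x) :=
  Ordinal.limitRecOn τ (fun _ => ⊥)
    (fun _ K x => (K (x + β.a)).comap (C.i x (x + β.a) rfl))
    (fun τ _ K x => ⨆ (ρ : Ordinal.{v}) (h : ρ < τ), K ρ h x)

/-- The cycles `Z^τ_y = k⁻¹ (I^τ_{y + c})` of order `τ`. -/
def cyclesOrd (τ : Ordinal.{v}) (y : ℤ × ℤ) : Submodule R (C.E y) :=
  (C.imageSub τ (y + β.c)).comap (C.k y (y + β.c) rfl)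

/-- The boundaries `B^τ_y = j (Ker (D_{y - b} → Q^τ_{y - b}))` of order `τ`. -/
def boundariesOrd (τ : Ordinal.{v}) (y : ℤ × ℤ) : Submodule R (C.E y) :=
  (C.quotKer τ (y - β.b)).map (C.j (y - β.b) y (sub_add_cancel y β.b))

/-- The objects `E^{τ+1} = Z^τ / B^τ` are stable from `α` on. -/
def IsStable (α : Ordinal.{v}) : Prop :=
  ∀ τ, α ≤ τ → ∀ y, C.cyclesOrd τ y = C.cyclesOrd α y ∧ C.boundariesOrd τ y = C.boundariesOrd α y

/-- The least ordinal from which on the objects `E^{τ+1}` are stable. -/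
def stableOrd : Ordinal.{v} := sInf {α | C.IsStable α}

/-- The stable cycles. -/
def cyclesStable (y : ℤ × ℤ) : Submodule R (C.E y) := C.cyclesOrd C.stableOrd y

/-- The stable boundaries. -/
def boundariesStable (y : ℤ × ℤ) : Submodule R (C.E y) := C.boundariesOrd C.stableOrd y

/-- The stable `E`-object `Ē_y`. -/
abbrev eStable (y : ℤ × ℤ) : Type v :=
  C.cyclesStable y ⧸ (C.boundariesStable y).submoduleOf (C.cyclesStable y)

/-! #### The spectral sequence of an exact couple -/

/-- `Z^r_y = k⁻¹ (Im i^r)`. -/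
def cyclesFin (r : ℕ) (y : ℤ × ℤ) : Submodule R (C.E y) :=
  (LinearMap.range (C.iter r (y + β.c - r • β.a) (y + β.c) (sub_add_cancel _ _))).comap
    (C.k y (y + β.c) rfl)

/-- `B^r_y = j (Ker i^r)`. -/
def boundariesFin (r : ℕ) (y : ℤ × ℤ) : Submodule R (C.E y) :=
  (LinearMap.ker (C.iter r (y - β.b) (y - β.b + r • β.a) rfl)).map
    (C.j (y - β.b) y (sub_add_cancel y β.b))

theorem mem_cyclesFin (r : ℕ) (y m z : ℤ × ℤ) (hz : y + β.c = z) (hm : m + r • β.a = z)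
    (e : C.E y) : e ∈ C.cyclesFin r y ↔ ∃ s, C.iter r m z hm s = C.k y z hz e := by
  subst hz
  obtain rfl : m = y + β.c - r • β.a := eq_sub_of_add_eq hm
  rfl

theorem mem_boundariesFin (r : ℕ) (y x z : ℤ × ℤ) (hx : x + β.b = y) (hz : x + r • β.a = z)
    (e : C.E y) :
    e ∈ C.boundariesFin r y ↔ ∃ s, C.iter r x z hz s = 0 ∧ C.j x y hx s = e := by
  subst hz
  obtain rfl : x = y - β.b := eq_sub_of_add_eq hx
  rfl

theorem j_mem_cyclesFin (r : ℕ) (x y : ℤ × ℤ) (h : x + β.b = y) (s : C.D x) :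
    C.j x y h s ∈ C.cyclesFin r y := by
  refine ⟨0, ?_⟩
  rw [map_zero]
  exact ((C.exact_jk x y _ h rfl).apply_apply_eq_zero s).symm

/-- The page `E^{r+1}_y = Z^r_y / B^r_y`. -/
abbrev ssPage (r : ℕ) (y : ℤ × ℤ) : Type v :=
  C.cyclesFin r y ⧸ (C.boundariesFin r y).submoduleOf (C.cyclesFin r y)

/-- The additive relation `j ∘ (i^r)⁻¹ ∘ k`, as a map `Z^r_y → E^{r+1}_{y'}`. -/
def ssRel (r : ℕ) (y y' : ℤ × ℤ) (h : y + (β.b + β.c - r • β.a) = y') :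
    C.cyclesFin r y →ₗ[R] C.ssPage r y' :=
  have h' : y + β.c - r • β.a + β.b = y' := by rw [← h]; abel
  let ir := C.iter r (y + β.c - r • β.a) (y + β.c) (sub_add_cancel _ _)
  (LinearMap.ker ir).liftQ
      (Submodule.mkQ _ ∘ₗ (C.j (y + β.c - r • β.a) y' h').codRestrict (C.cyclesFin r y')
        (C.j_mem_cyclesFin r _ y' h'))
      (by
        intro s hs
        rw [LinearMap.mem_ker, LinearMap.comp_apply, Submodule.mkQ_apply,
          Submodule.Quotient.mk_eq_zero, Submodule.submoduleOf, Submodule.mem_comap]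
        exact (C.mem_boundariesFin r y' _ _ h' (sub_add_cancel _ _) _).2 ⟨s, hs, rfl⟩) ∘ₗ
    ir.quotKerEquivRange.symm.toLinearMap ∘ₗ
    (C.k y (y + β.c) rfl).restrict (p := C.cyclesFin r y) (q := LinearMap.range ir) fun _ he => he

theorem ssRel_apply (r : ℕ) (y y' m z : ℤ × ℤ) (h : y + (β.b + β.c - r • β.a) = y')
    (hz : y + β.c = z) (hm : m + r • β.a = z) (hj : m + β.b = y') (e : C.cyclesFin r y)
    (s : C.D m) (hs : C.iter r m z hm s = C.k y z hz e) :
    C.ssRel r y y' h e = Submodule.Quotient.mk ⟨C.j m y' hj s, C.j_mem_cyclesFin r m y' hj s⟩ := by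
  subst hz
  obtain rfl : m = y + β.c - r • β.a := eq_sub_of_add_eq hm
  have : (C.iter r (y + β.c - r • β.a) (y + β.c) hm).quotKerEquivRange.symm
      ⟨C.k y (y + β.c) rfl e, e.2⟩ = Submodule.Quotient.mk s := by
    rw [LinearEquiv.symm_apply_eq]
    exact Subtype.ext hs.symm
  simp only [ssRel, LinearMap.comp_apply]
  erw [this]
  rfl

/-- The differential `d^{r+1}` on the page `E^{r+1}`, of bidegree `b + c - r a`: the class of `e`
goes to the class of `j s`, for any `s` with `i^r s = k e`. -/
def ssD (r : ℕ) (y y' : ℤ × ℤ) (h : y + (β.b + β.c - r • β.a) = y') :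
    C.ssPage r y →ₗ[R] C.ssPage r y' :=
  Submodule.liftQ _ (C.ssRel r y y' h) (by
    intro e he
    rw [Submodule.submoduleOf, Submodule.mem_comap,
      C.mem_boundariesFin r y (y - β.b) _ (sub_add_cancel _ _) rfl] at he
    obtain ⟨s, -, hs⟩ := he
    have hj : y + β.c - r • β.a + β.b = y' := by rw [← h]; abel
    rw [LinearMap.mem_ker, C.ssRel_apply r y y' _ _ h rfl (sub_add_cancel _ _) hj e 0]
    · rw [Submodule.Quotient.mk_eq_zero, Submodule.submoduleOf, Submodule.mem_comap]
      simp
    · rw [map_zero]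
      change (0 : C.D (y + β.c)) = C.k y (y + β.c) rfl ((C.cyclesFin r y).subtype e)
      rw [← hs]
      exact ((C.exact_jk _ y _ _ rfl).apply_apply_eq_zero s).symm)

theorem ssD_mk (r : ℕ) (y y' m z : ℤ × ℤ) (h : y + (β.b + β.c - r • β.a) = y')
    (hz : y + β.c = z) (hm : m + r • β.a = z) (hj : m + β.b = y') (e : C.cyclesFin r y)
    (s : C.D m) (hs : C.iter r m z hm s = C.k y z hz e) :
    C.ssD r y y' h (Submodule.Quotient.mk e) =
      Submodule.Quotient.mk ⟨C.j m y' hj s, C.j_mem_cyclesFin r m y' hj s⟩ :=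
  C.ssRel_apply r y y' m z h hz hm hj e s hs

theorem ssD_comp_ssD (r : ℕ) (x y z : ℤ × ℤ) (h : x + (β.b + β.c - r • β.a) = y)
    (h' : y + (β.b + β.c - r • β.a) = z) : C.ssD r y z h' ∘ₗ C.ssD r x y h = 0 := by
  ext e
  obtain ⟨s, hs⟩ := (C.mem_cyclesFin r x (x + β.c - r • β.a) _ rfl (sub_add_cancel _ _) e).1 e.2
  have hj : x + β.c - r • β.a + β.b = y := by rw [← h]; abel
  have hj' : y + β.c - r • β.a + β.b = z := by rw [← h']; abel
  simp only [LinearMap.comp_apply, Submodule.mkQ_apply, LinearMap.zero_apply]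
  rw [C.ssD_mk r x y _ _ h rfl (sub_add_cancel _ _) hj e s hs,
    C.ssD_mk r y z _ _ h' rfl (sub_add_cancel _ _) hj' _ 0]
  · rw [Submodule.Quotient.mk_eq_zero, Submodule.submoduleOf, Submodule.mem_comap]
    simp
  · rw [map_zero]
    exact ((C.exact_jk _ y _ hj rfl).apply_apply_eq_zero s).symm

theorem iter_succ' (r : ℕ) (x y z : ℤ × ℤ) (h : x + (r + 1) • β.a = z) (h' : x + β.a = y)
    (h'' : y + r • β.a = z) (s : C.D x) :
    C.iter (r + 1) x z h s = C.iter r y z h'' (C.i x y h' s) := by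
  subst h'; rfl

theorem iter_succ (r : ℕ) (x y z : ℤ × ℤ) (h : x + (r + 1) • β.a = z) (h' : x + r • β.a = y)
    (h'' : y + β.a = z) (s : C.D x) :
    C.iter (r + 1) x z h s = C.i y z h'' (C.iter r x y h' s) := by
  induction r generalizing x with
  | zero =>
    obtain rfl : x = y := by simpa using h'
    subst h''
    rfl
  | succ r ih =>
    have e1 : x + β.a + (r + 1) • β.a = z := by rw [← h, add_assoc, ← succ_nsmul']
    have e2 : x + β.a + r • β.a = y := by rw [← h', add_assoc, ← succ_nsmul']
    rw [C.iter_succ' (r + 1) x (x + β.a) z h rfl e1, ih _ e1 e2,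
      ← C.iter_succ' r x (x + β.a) y h' rfl e2]

theorem cyclesFin_succ_le (r : ℕ) (y : ℤ × ℤ) : C.cyclesFin (r + 1) y ≤ C.cyclesFin r y := by
  intro e he
  have h1 : y + β.c - (r + 1) • β.a + (r + 1) • β.a = y + β.c := sub_add_cancel _ _
  have h2 : y + β.c - (r + 1) • β.a + β.a + r • β.a = y + β.c := by
    rw [add_assoc, ← succ_nsmul', sub_add_cancel]
  obtain ⟨s, hs⟩ := (C.mem_cyclesFin (r + 1) y _ _ rfl h1 e).1 he
  exact (C.mem_cyclesFin r y _ _ rfl h2 e).2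
    ⟨C.i _ _ rfl s, by rw [← hs]; exact (C.iter_succ' r _ _ _ h1 rfl h2 s).symm⟩

/-- `Ker d^{r+1} = Z^{r+1} / B^r`. -/
theorem ssD_mk_eq_zero_iff (r : ℕ) (y y' : ℤ × ℤ) (h : y + (β.b + β.c - r • β.a) = y')
    (e : C.cyclesFin r y) :
    C.ssD r y y' h (Submodule.Quotient.mk e) = 0 ↔ (e : C.E y) ∈ C.cyclesFin (r + 1) y := by
  have hm : y + β.c - r • β.a + r • β.a = y + β.c := sub_add_cancel _ _
  have hj : y + β.c - r • β.a + β.b = y' := by rw [← h]; abel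
  have h1 : y + β.c - (r + 1) • β.a + (r + 1) • β.a = y + β.c := sub_add_cancel _ _
  have h2 : y + β.c - (r + 1) • β.a + β.a = y + β.c - r • β.a := by rw [succ_nsmul]; abel
  obtain ⟨s, hs⟩ := (C.mem_cyclesFin r y _ _ rfl hm e).1 e.2
  rw [C.ssD_mk r y y' _ _ h rfl hm hj e s hs, Submodule.Quotient.mk_eq_zero,
    Submodule.submoduleOf, Submodule.mem_comap, C.mem_cyclesFin (r + 1) y _ _ rfl h1]
  change C.j _ y' hj s ∈ _ ↔ _
  rw [C.mem_boundariesFin r y' _ _ hj hm]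
  constructor
  · rintro ⟨s', hs', hjs⟩
    obtain ⟨t, ht⟩ := (C.exact_ij _ _ _ h2 hj (s - s')).1 (by rw [map_sub, hjs, sub_self])
    refine ⟨t, ?_⟩
    rw [C.iter_succ' r _ _ _ h1 h2 hm, ht, map_sub, hs, hs', sub_zero]
  · rintro ⟨t, ht⟩
    refine ⟨s - C.i _ _ h2 t, ?_, ?_⟩
    · rw [map_sub, hs, ← C.iter_succ' r _ _ _ h1 h2 hm, ht, sub_self]
    · rw [map_sub, (C.exact_ij _ _ _ h2 hj).apply_apply_eq_zero, sub_zero]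

/-- `Im d^{r+1} = B^{r+1} / B^r`. -/
theorem mk_mem_range_ssD_iff (r : ℕ) (x y : ℤ × ℤ) (h : x + (β.b + β.c - r • β.a) = y)
    (e : C.cyclesFin r y) :
    Submodule.Quotient.mk e ∈ LinearMap.range (C.ssD r x y h) ↔
      (e : C.E y) ∈ C.boundariesFin (r + 1) y := by
  have hj : y - β.b + β.b = y := sub_add_cancel _ _
  have hz : y - β.b + r • β.a = x + β.c := by rw [← h]; abel
  have hz' : y - β.b + (r + 1) • β.a = x + β.c + β.a := by rw [succ_nsmul, ← add_assoc, hz]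
  rw [C.mem_boundariesFin (r + 1) y _ _ hj hz']
  constructor
  · rintro ⟨q, hq⟩
    obtain ⟨z, rfl⟩ := Submodule.Quotient.mk_surjective _ q
    obtain ⟨s, hs⟩ := (C.mem_cyclesFin r x _ _ rfl hz z).1 z.2
    rw [C.ssD_mk r x y _ _ h rfl hz hj z s hs, Submodule.Quotient.eq, Submodule.submoduleOf,
      Submodule.mem_comap] at hq
    obtain ⟨s', hs', hjs⟩ := (C.mem_boundariesFin r y _ _ hj hz _).1 hq
    refine ⟨s - s', ?_, ?_⟩
    · rw [C.iter_succ r _ _ _ hz' hz rfl, map_sub, hs', sub_zero, hs]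
      exact (C.exact_ki _ _ _ rfl rfl).apply_apply_eq_zero _
    · rw [map_sub, hjs]
      simp
  · rintro ⟨s, hs, hjs⟩
    rw [C.iter_succ r _ _ _ hz' hz rfl] at hs
    obtain ⟨z, hz1⟩ := (C.exact_ki x _ _ rfl rfl _).1 hs
    have hz2 : z ∈ C.cyclesFin r x := (C.mem_cyclesFin r x _ _ rfl hz z).2 ⟨s, hz1.symm⟩
    refine ⟨Submodule.Quotient.mk ⟨z, hz2⟩, ?_⟩
    rw [C.ssD_mk r x y _ _ h rfl hz hj ⟨z, hz2⟩ s hz1.symm]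
    congr 1
    exact Subtype.ext hjs

/-- The map from `Z^{r+1}` to the homology of the page `E^{r+1}`, sending `e` to its class. -/
def ssToHomology (r : ℕ) (y x' y' : ℤ × ℤ) (h : x' + (β.b + β.c - r • β.a) = y)
    (h' : y + (β.b + β.c - r • β.a) = y') :
    C.cyclesFin (r + 1) y →ₗ[R]
      LinearMap.ker (C.ssD r y y' h') ⧸
        (LinearMap.range (C.ssD r x' y h)).submoduleOf (LinearMap.ker (C.ssD r y y' h')) :=
  Submodule.mkQ _ ∘ₗ
    (Submodule.mkQ _ ∘ₗ Submodule.inclusion (C.cyclesFin_succ_le r y)).codRestrict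
      (LinearMap.ker (C.ssD r y y' h')) fun e => (C.ssD_mk_eq_zero_iff r y y' h' _).2 e.2

theorem ssToHomology_surjective (r : ℕ) (y x' y' : ℤ × ℤ) (h : x' + (β.b + β.c - r • β.a) = y)
    (h' : y + (β.b + β.c - r • β.a) = y') :
    Function.Surjective (C.ssToHomology r y x' y' h h') := by
  intro q
  obtain ⟨⟨q, hq⟩, rfl⟩ := Submodule.Quotient.mk_surjective _ q
  obtain ⟨e, rfl⟩ := Submodule.Quotient.mk_surjective _ q
  exact ⟨⟨e, (C.ssD_mk_eq_zero_iff r y y' h' e).1 hq⟩, rfl⟩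

theorem ker_ssToHomology (r : ℕ) (y x' y' : ℤ × ℤ) (h : x' + (β.b + β.c - r • β.a) = y)
    (h' : y + (β.b + β.c - r • β.a) = y') :
    LinearMap.ker (C.ssToHomology r y x' y' h h') =
      (C.boundariesFin (r + 1) y).submoduleOf (C.cyclesFin (r + 1) y) := by
  ext e
  rw [LinearMap.mem_ker, ssToHomology, LinearMap.comp_apply, Submodule.mkQ_apply,
    Submodule.Quotient.mk_eq_zero]
  exact C.mk_mem_range_ssD_iff r x' y h (Submodule.inclusion (C.cyclesFin_succ_le r y) e)

/-- The spectral sequence of an exact couple: `E^{r+1}_y = Z^r_y / B^r_y`, where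
`Z^r = k⁻¹ (Im i^r)` and `B^r = j (Ker i^r)`, and `d^{r+1}` is induced by `j ∘ (i^r)⁻¹ ∘ k`. The
class of `e ∈ Z^{r+1}` corresponds to the homology class of the class of `e` in `E^{r+1}`. -/
def spectralSequence :
    BigradedSpectralSequence.{u, v} R (fun r => β.b + β.c - r • β.a) where
  page := C.ssPage
  d := C.ssD
  d_comp_d := C.ssD_comp_ssD
  homologyIso r y :=
    (Submodule.quotEquivOfEq _ _ (C.ker_ssToHomology r y _ _ (sub_add_cancel _ _) rfl).symm).trans
      ((C.ssToHomology r y _ _ (sub_add_cancel _ _) rfl).quotKerEquivOfSurjective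
        (C.ssToHomology_surjective r y _ _ _ rfl))

/-- The identification of `E` with the first page `E^1 = Z^0 / B^0 = E / 0`. -/
def toFirstPage (y : ℤ × ℤ) : C.E y →ₗ[R] C.spectralSequence.page 0 y :=
  Submodule.mkQ _ ∘ₗ LinearMap.codRestrict (C.cyclesFin 0 y) LinearMap.id fun e =>
    (C.mem_cyclesFin 0 y _ _ rfl (by simp) e).2 ⟨C.k y (y + β.c) rfl e, rfl⟩

/-- The cycles `Z^∞_y` of the spectral sequence, as a submodule of `E_y = E^1_y`. -/
def cyclesInf (y : ℤ × ℤ) : Submodule R (C.E y) :=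
  (C.spectralSequence.cyclesInf y).comap (C.toFirstPage y)

/-- The boundaries `B^∞_y` of the spectral sequence, as a submodule of `E_y = E^1_y`. -/
def boundariesInf (y : ℤ × ℤ) : Submodule R (C.E y) :=
  (C.spectralSequence.boundariesInf y).comap (C.toFirstPage y)

/-- The limit page `E^∞_y = Z^∞_y / B^∞_y` of the spectral sequence. -/
abbrev eInf (y : ℤ × ℤ) : Type v :=
  C.cyclesInf y ⧸ (C.boundariesInf y).submoduleOf (C.cyclesInf y)

/-- The image of `j` in `E_{x + b}`, which equals the kernel of `k` by exactness. -/
def rangeJ (x : ℤ × ℤ) : Submodule R (C.E (x + β.b)) := LinearMap.range (C.j x (x + β.b) rfl)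

/-- The quotient `Z^∞_{x + b} / Im j_x`. -/
abbrev cyclesQuot (x : ℤ × ℤ) : Type v :=
  C.cyclesInf (x + β.b) ⧸ (C.rangeJ x).submoduleOf (C.cyclesInf (x + β.b))

/-! #### The diagrams of the extension theorem -/

/-- `lim¹` of the tower `Ker (i^r : D (w - r a) → D w)`, `r ≥ 0`, extended by `0`. -/
abbrev lim1Ker (w : ℤ × ℤ) : Type v := ((C.column w).kernelDiagram 0).lim1

/-- `lim¹` of the tower `Ker (i^{r+1} : D (w - r a) → D (w + a))`, `r ≥ 0`, extended by `0`. -/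
abbrev lim1KerNext (w : ℤ × ℤ) : Type v := ((C.column w).kernelDiagram 1).lim1

/-- The map of `lim¹`-modules induced by the inclusions `Ker i^r → Ker i^{r+1}`. -/
abbrev lim1KerMap (w : ℤ × ℤ) : C.lim1Ker w →ₗ[R] C.lim1KerNext w :=
  ((C.column w).kernelInclusion 0 1 zero_le_one).lim1Map

/-- The two diagrams of the `E`-infinity extension theorem in position `x`, with `w = x + b + c`:
a morphism of short exact sequences which is a pullback
```
L_x / L_{x-a}  >-->  Ē_{x+b}    -->>  L^{w+a} / L^w
     ||                 |                  | M
L_x / L_{x-a}  >-->  E^∞_{x+b}  -->>  Z^∞_{x+b} / Im j_x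
```
and an exact sequence
`0 → L^w → L^{w+a} --t--> Z^∞_{x+b} / Im j_x --δ--> lim¹ Ker i^r → lim¹ Ker i^{r+1}`,
such that `M` is the monomorphism in the image factorization of `t`. -/
structure EInfinityExtension (x : ℤ × ℤ) where
  /- The submodules by which one divides are contained in the ambient ones. -/
  colimStagePrev_le : C.colimStagePrev hβ x ≤ C.colimStage hβ x
  limStage_le : C.limStage hβ (x + β.b + β.c) ≤ C.limStageNext hβ (x + β.b + β.c)
  boundariesStable_le : C.boundariesStable (x + β.b) ≤ C.cyclesStable (x + β.b)
  boundariesInf_le : C.boundariesInf (x + β.b) ≤ C.cyclesInf (x + β.b)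
  rangeJ_le : C.rangeJ x ≤ C.cyclesInf (x + β.b)
  cyclesStable_le : C.cyclesStable (x + β.b) ≤ C.cyclesInf (x + β.b)
  /- The top row. -/
  topIncl : C.colimQuot hβ x →ₗ[R] C.eStable (x + β.b)
  topProj : C.eStable (x + β.b) →ₗ[R] C.limQuot hβ (x + β.b + β.c)
  topIncl_injective : Function.Injective topIncl
  top_exact : Function.Exact topIncl topProj
  topProj_surjective : Function.Surjective topProj
  /- The bottom row. -/
  botIncl : C.colimQuot hβ x →ₗ[R] C.eInf (x + β.b)
  botProj : C.eInf (x + β.b) →ₗ[R] C.cyclesQuot x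
  botIncl_injective : Function.Injective botIncl
  bot_exact : Function.Exact botIncl botProj
  botProj_surjective : Function.Surjective botProj
  /- The vertical maps; the square on the right is a pullback. -/
  mid : C.eStable (x + β.b) →ₗ[R] C.eInf (x + β.b)
  M : C.limQuot hβ (x + β.b + β.c) →ₗ[R] C.cyclesQuot x
  mid_injective : Function.Injective mid
  M_injective : Function.Injective M
  comm_left : mid ∘ₗ topIncl = botIncl
  comm_right : botProj ∘ₗ mid = M ∘ₗ topProj
  pullback : ∀ e l, botProj e = M l → ∃! s, mid s = e ∧ topProj s = l
  /- The 5-term exact sequence. -/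
  t : C.limStageNext hβ (x + β.b + β.c) →ₗ[R] C.cyclesQuot x
  δ : C.cyclesQuot x →ₗ[R] C.lim1Ker (x + β.b + β.c)
  exact_t : Function.Exact (Submodule.inclusion limStage_le) t
  exact_δ : Function.Exact t δ
  exact_lim1 : Function.Exact δ (C.lim1KerMap (x + β.b + β.c))
  t_eq : t = M ∘ₗ Submodule.mkQ _
  /- The maps are the canonical ones. -/
  mid_mk : ∀ z : C.cyclesStable (x + β.b),
    mid (Submodule.Quotient.mk z) = Submodule.Quotient.mk (Submodule.inclusion cyclesStable_le z)
  botProj_mk : ∀ z : C.cyclesInf (x + β.b),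
    botProj (Submodule.Quotient.mk z) = Submodule.Quotient.mk z
  botIncl_mk : ∀ s : C.D x,
    botIncl (Submodule.Quotient.mk ⟨C.colimMap hβ _ x rfl s, LinearMap.mem_range_self _ s⟩) =
      Submodule.Quotient.mk ⟨C.j x _ rfl s, rangeJ_le (LinearMap.mem_range_self _ s)⟩
  t_apply : ∀ (s : C.limStageNext hβ (x + β.b + β.c)) (z : C.cyclesInf (x + β.b)),
    C.k _ (x + β.b + β.c) rfl z = C.limMap hβ _ (x + β.b + β.c) rfl s →
      t s = Submodule.Quotient.mk z
  /- `δ` is the connecting homomorphism: if `y` is a family of elements of `Ker i^{r+1}` with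
  `i^r (y_{-r}) = k z` for all `r ≥ 0`, and if the family `u` of elements of `Ker i^r` maps to
  the family of differences `y_q - i (y_{q-1})`, then `δ [z] = [u]`. -/
  δ_mk : ∀ (z : C.cyclesInf (x + β.b))
      (y : ∀ p, ((C.column (x + β.b + β.c)).kernelDiagram 1).obj p)
      (u : ∀ p, ((C.column (x + β.b + β.c)).kernelDiagram 0).obj p),
    (∀ (p : ℤ) (hp : p ≤ 0), (C.column (x + β.b + β.c)).map p 0 hp (y p).1 =
      C.k (x + β.b) (x + β.b + β.c + (0 : ℤ) • β.a) (by simp) z) →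
    (∀ p, ((C.column (x + β.b + β.c)).kernelInclusion 0 1 zero_le_one).app p (u p) =
      ((C.column (x + β.b + β.c)).kernelDiagram 1).limDiff y p) →
    δ (Submodule.Quotient.mk z) = Submodule.Quotient.mk u

/-! #### Functoriality -/

variable {C C' C'' : ExactCouple.{u, v} R β}

/-- The maps which a morphism of exact couples induces on the objects of the two diagrams. -/
structure InducedMaps (φ : Hom C C') (x : ℤ × ℤ) where
  colimQuot : C.colimQuot hβ x →ₗ[R] C'.colimQuot hβ x
  limStage : C.limStage hβ (x + β.b + β.c) →ₗ[R] C'.limStage hβ (x + β.b + β.c)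
  limStageNext : C.limStageNext hβ (x + β.b + β.c) →ₗ[R] C'.limStageNext hβ (x + β.b + β.c)
  limQuot : C.limQuot hβ (x + β.b + β.c) →ₗ[R] C'.limQuot hβ (x + β.b + β.c)
  eStable : C.eStable (x + β.b) →ₗ[R] C'.eStable (x + β.b)
  eInf : C.eInf (x + β.b) →ₗ[R] C'.eInf (x + β.b)
  cyclesQuot : C.cyclesQuot x →ₗ[R] C'.cyclesQuot x
  cyclesStable_le : C.cyclesStable (x + β.b) ≤ (C'.cyclesStable (x + β.b)).comap (φ.g _)
  cyclesInf_le : C.cyclesInf (x + β.b) ≤ (C'.cyclesInf (x + β.b)).comap (φ.g _)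
  colimQuot_mk : ∀ s : C.D x,
    colimQuot (Submodule.Quotient.mk ⟨C.colimMap hβ _ x rfl s, LinearMap.mem_range_self _ s⟩) =
      Submodule.Quotient.mk ⟨C'.colimMap hβ _ x rfl (φ.f x s), LinearMap.mem_range_self _ _⟩
  limStage_apply : ∀ s p, (limStage s).1.1 p = φ.f _ (s.1.1 p)
  limStageNext_apply : ∀ s p, (limStageNext s).1.1 p = φ.f _ (s.1.1 p)
  limQuot_mk : ∀ s, limQuot (Submodule.Quotient.mk s) = Submodule.Quotient.mk (limStageNext s)
  eStable_mk : ∀ z : C.cyclesStable (x + β.b),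
    eStable (Submodule.Quotient.mk z) = Submodule.Quotient.mk ⟨φ.g _ z, cyclesStable_le z.2⟩
  eInf_mk : ∀ z : C.cyclesInf (x + β.b),
    eInf (Submodule.Quotient.mk z) = Submodule.Quotient.mk ⟨φ.g _ z, cyclesInf_le z.2⟩
  cyclesQuot_mk : ∀ z : C.cyclesInf (x + β.b),
    cyclesQuot (Submodule.Quotient.mk z) = Submodule.Quotient.mk ⟨φ.g _ z, cyclesInf_le z.2⟩

/-- The map induced on `lim¹ Ker i^r`. -/
abbrev Hom.lim1Ker (φ : Hom C C') (w : ℤ × ℤ) : C.lim1Ker w →ₗ[R] C'.lim1Ker w :=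
  ((φ.column w).kernelMap 0).lim1Map

/-- The map induced on `lim¹ Ker i^{r+1}`. -/
abbrev Hom.lim1KerNext (φ : Hom C C') (w : ℤ × ℤ) : C.lim1KerNext w →ₗ[R] C'.lim1KerNext w :=
  ((φ.column w).kernelMap 1).lim1Map

variable {hβ}

/-- The induced maps commute with all maps in the two diagrams. -/
structure InducedMaps.Commutes {φ : Hom C C'} {x : ℤ × ℤ} (F : InducedMaps hβ φ x)
    (S : C.EInfinityExtension hβ x) (S' : C'.EInfinityExtension hβ x) : Prop where
  topIncl : F.eStable ∘ₗ S.topIncl = S'.topIncl ∘ₗ F.colimQuot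
  topProj : F.limQuot ∘ₗ S.topProj = S'.topProj ∘ₗ F.eStable
  botIncl : F.eInf ∘ₗ S.botIncl = S'.botIncl ∘ₗ F.colimQuot
  botProj : F.cyclesQuot ∘ₗ S.botProj = S'.botProj ∘ₗ F.eInf
  mid : F.eInf ∘ₗ S.mid = S'.mid ∘ₗ F.eStable
  M : F.cyclesQuot ∘ₗ S.M = S'.M ∘ₗ F.limQuot
  incl : F.limStageNext ∘ₗ Submodule.inclusion S.limStage_le =
    Submodule.inclusion S'.limStage_le ∘ₗ F.limStage
  t : F.cyclesQuot ∘ₗ S.t = S'.t ∘ₗ F.limStageNext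
  δ : φ.lim1Ker _ ∘ₗ S.δ = S'.δ ∘ₗ F.cyclesQuot
  lim1 : φ.lim1KerNext (x + β.b + β.c) ∘ₗ C.lim1KerMap _ = C'.lim1KerMap _ ∘ₗ φ.lim1Ker _

/-- All maps in `F` are identities. -/
structure InducedMaps.IsId {x : ℤ × ℤ} (F : InducedMaps hβ (Hom.id C) x) : Prop where
  colimQuot : F.colimQuot = LinearMap.id
  limStage : F.limStage = LinearMap.id
  limStageNext : F.limStageNext = LinearMap.id
  limQuot : F.limQuot = LinearMap.id
  eStable : F.eStable = LinearMap.id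
  eInf : F.eInf = LinearMap.id
  cyclesQuot : F.cyclesQuot = LinearMap.id
  lim1Ker : (Hom.id C).lim1Ker (x + β.b + β.c) = LinearMap.id
  lim1KerNext : (Hom.id C).lim1KerNext (x + β.b + β.c) = LinearMap.id

/-- The maps in `H` are the composites of those in `F` and `G`. -/
structure InducedMaps.IsComp {φ : Hom C C'} {ψ : Hom C' C''} {x : ℤ × ℤ}
    (F : InducedMaps hβ φ x) (G : InducedMaps hβ ψ x) (H : InducedMaps hβ (φ.comp ψ) x) :
    Prop where
  colimQuot : H.colimQuot = G.colimQuot ∘ₗ F.colimQuot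
  limStage : H.limStage = G.limStage ∘ₗ F.limStage
  limStageNext : H.limStageNext = G.limStageNext ∘ₗ F.limStageNext
  limQuot : H.limQuot = G.limQuot ∘ₗ F.limQuot
  eStable : H.eStable = G.eStable ∘ₗ F.eStable
  eInf : H.eInf = G.eInf ∘ₗ F.eInf
  cyclesQuot : H.cyclesQuot = G.cyclesQuot ∘ₗ F.cyclesQuot
  lim1Ker : (φ.comp ψ).lim1Ker (x + β.b + β.c) = ψ.lim1Ker _ ∘ₗ φ.lim1Ker _
  lim1KerNext : (φ.comp ψ).lim1KerNext (x + β.b + β.c) = ψ.lim1KerNext _ ∘ₗ φ.lim1KerNext _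

end ExactCouple

end

noncomputable section

/-! The transfinite stages can be expressed through the abutments. The images I^τ_x decrease with τ,
so for reasons of size they become constant at some α. Then i maps I^α_{x-a} onto I^α_x for all x,
and choosing preimages step by step extends every element of I^α_x to an element of the limit
abutment. Hence I^τ_x = Im ρ^x for τ ≥ α (`exists_imageSub_eq_range`). The submodules N^τ_x are
constant from ω on, with value ⋃ Ker i^r = Ker π_x (`quotKer_eq_ker_colimMap`). So the stable cycles
are Z = k⁻¹(Im ρ), and the stable boundaries j(Ker π) coincide with B^∞.

For the bottom row, the maps from D_x to L_x/L_{x-a} and, via j, to E^∞ have the same kernel Im i +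
Ker π_x (`toColimQuot_eq_zero_iff`), and the image of the second one is Im j/B^∞. If s lies in
L^{w+a}, then i(ρ^w(s)) = 0, so ρ^w(s) = k(z) with z unique modulo Ker k = Im j. This defines t; its
kernel is L^w and its image is Z/Im j. Hence M is injective with image Z/Im j, and Ē is the preimage
of that image in E^∞ (`botProj_mem_range_iff`). The top row is the pullback of the bottom row along
M.

The 5-term sequence belongs to the short exact sequence of towers Ker i^r → Ker i^{r+1} → Ker i ∩ Im
i^r, whose second map is i^r. The limits are L^w, L^{w+a} and k(Z^∞) ≅ Z^∞/Im j, and the sequence is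
the beginning of the lim-lim¹ sequence. Its exactness is checked on elements; δ comes from the
linear relation `connectingRel`, so that no linear choice of lifts is needed.

Functoriality follows because every map is determined either by its values on representatives or by
the injectivity of the two vertical maps. -/

/-! ### Linear maps defined by relations, and lifts along injections -/

/-- The linear map `t` with `t s = q z` whenever `f s = g z`. -/
def LinearMap.relLift {R S D Z Q : Type*} [Ring R] [AddCommGroup S] [AddCommGroup D]
    [AddCommGroup Z] [AddCommGroup Q] [Module R S] [Module R D] [Module R Z] [Module R Q]
    (f : S →ₗ[R] D) (g : Z →ₗ[R] D) (q : Z →ₗ[R] Q) (h : ∀ s, f s ∈ LinearMap.range g)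
    (hk : LinearMap.ker g ≤ LinearMap.ker q) : S →ₗ[R] Q :=
  (LinearMap.ker g).liftQ q hk ∘ₗ g.quotKerEquivRange.symm.toLinearMap ∘ₗ
    f.codRestrict (LinearMap.range g) h

/-- The element z may be any one related to s. The maps `botIncl`, `limToCycles` and `connecting`
are all evaluated through this rule. -/
theorem LinearMap.relLift_eq {R S D Z Q : Type*} [Ring R] [AddCommGroup S] [AddCommGroup D]
    [AddCommGroup Z] [AddCommGroup Q] [Module R S] [Module R D] [Module R Z] [Module R Q]
    {f : S →ₗ[R] D} {g : Z →ₗ[R] D} {q : Z →ₗ[R] Q} {h : ∀ s, f s ∈ LinearMap.range g}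
    {hk : LinearMap.ker g ≤ LinearMap.ker q} {s : S} {z : Z} (hs : f s = g z) :
    LinearMap.relLift f g q h hk s = q z := by
  have : g.quotKerEquivRange.symm ⟨f s, h s⟩ = Submodule.Quotient.mk z := by
    rw [LinearEquiv.symm_apply_eq]
    exact Subtype.ext hs
  change (LinearMap.ker g).liftQ q hk (g.quotKerEquivRange.symm ⟨f s, h s⟩) = _
  rw [this]
  rfl

/-- The lift of `g` along an injection `f` with `Im g ≤ Im f`. -/
def LinearMap.liftInjective {R A B C : Type*} [Ring R] [AddCommGroup A] [AddCommGroup B]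
    [AddCommGroup C] [Module R A] [Module R B] [Module R C] (f : B →ₗ[R] C) (g : A →ₗ[R] C)
    (hf : Function.Injective f) (h : ∀ x, g x ∈ LinearMap.range f) : A →ₗ[R] B :=
  (LinearEquiv.ofInjective f hf).symm.toLinearMap ∘ₗ g.codRestrict (LinearMap.range f) h

theorem LinearMap.apply_liftInjective {R A B C : Type*} [Ring R] [AddCommGroup A]
    [AddCommGroup B] [AddCommGroup C] [Module R A] [Module R B] [Module R C] (f : B →ₗ[R] C)
    (g : A →ₗ[R] C) (hf : Function.Injective f) (h : ∀ x, g x ∈ LinearMap.range f) (x : A) :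
    f (f.liftInjective g hf h x) = g x :=
  congrArg Subtype.val ((LinearEquiv.ofInjective f hf).apply_symm_apply ⟨g x, h x⟩)

/-! ### Limits and colimits of `ℤ`-diagrams -/

namespace ZDiagram

variable {R : Type u} [Ring R] (A : ZDiagram.{u, v} R)

theorem limDiff_apply (s : ∀ p, A.obj p) (q : ℤ) :
    A.limDiff s q = s q - A.map (q - 1) q (by omega) (s (q - 1)) := rfl

theorem mem_lim {s : ∀ p, A.obj p} :
    s ∈ A.lim ↔ ∀ q, A.map (q - 1) q (by omega) (s (q - 1)) = s q := by
  rw [lim, LinearMap.mem_ker, funext_iff]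
  refine forall_congr' fun q => ?_
  rw [limDiff_apply, Pi.zero_apply, sub_eq_zero, eq_comm]

theorem map_eq_of_eq {s : ∀ p, A.obj p} {p q : ℤ} (h : p = q) (h' : p ≤ q) :
    A.map p q h' (s p) = s q := by
  subst h; exact A.map_self p _

/-- A transition map is a composite of unit steps, so compatibility with unit steps, which is all
that `lim` records, gives compatibility with every transition map. -/
theorem map_of_step (q₀ : ℤ) (s : ∀ p, A.obj p)
    (hs : ∀ q ≤ q₀, A.map (q - 1) q (by omega) (s (q - 1)) = s q) (p q : ℤ) (h : p ≤ q)
    (hq : q ≤ q₀) : A.map p q h (s p) = s q := by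
  obtain ⟨n, hn⟩ : ∃ n : ℕ, q = p + n := ⟨(q - p).toNat, by omega⟩
  induction n generalizing q with
  | zero => exact A.map_eq_of_eq (by omega) h
  | succ n ih =>
    rw [← hs q hq, ← ih (q - 1) (by omega) (by omega) (by omega), A.map_map]

theorem map_of_mem_lim {s : ∀ p, A.obj p} (hs : s ∈ A.lim) (p q : ℤ) (h : p ≤ q) :
    A.map p q h (s p) = s q :=
  A.map_of_step q s (fun q _ => A.mem_lim.1 hs q) p q h le_rfl

/-- If the sets `I p` are such that every element of `I p` comes from `I (p - 1)`, then their
elements extend to elements of the limit. -/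
theorem exists_mem_lim (I : ∀ p, Set (A.obj p))
    (hI : ∀ p q (h : q ≤ p), q = p - 1 → ∀ d ∈ I p, ∃ d' ∈ I q, A.map q p h d' = d)
    (p : ℤ) (d : A.obj p) (hd : d ∈ I p) : ∃ s ∈ A.lim, s p = d := by
  -- Dependent choice downwards from p: `g n` picks a preimage in position p - (n + 1) of an element
  -- in position p - n.
  choose g hg hg' using fun (n : ℕ) (e : I (p - n)) =>
    hI (p - n) (p - (n + 1 : ℕ)) (by omega) (by omega) e.1 e.2
  have hp : p = p - (0 : ℕ) := by simp
  -- The recursion starts in position p - 0, which equals p only propositionally, so d is first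
  -- moved there.
  have start : ∀ q, p = q → ∃ e ∈ I q, ∀ h : q ≤ p, A.map q p h e = d := by
    rintro _ rfl
    exact ⟨d, hd, fun h => A.map_self p d⟩
  obtain ⟨e, he, he'⟩ := start _ hp
  let t : (n : ℕ) → I (p - n) := fun n => Nat.rec ⟨e, he⟩ (fun n e => ⟨g n e, hg n e⟩) n
  have ht : ∀ n h, A.map (p - (n + 1 : ℕ)) (p - n) h (t (n + 1)).1 = (t n).1 :=
    fun n h => hg' n (t n)
  -- For q ≤ p the coordinate is the chosen element in position q. For q > p the truncated
  -- difference is 0, and the coordinate is the image of d.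
  refine ⟨fun q => A.map (p - (p - q).toNat) q (by omega) (t (p - q).toNat).1, ?_, ?_⟩
  · rw [mem_lim]
    intro q
    rw [A.map_map]
    by_cases h : q ≤ p
    · have key : ∀ n m (hn : p - (n : ℕ) ≤ q) (hm : p - (m : ℕ) ≤ q), m = n + 1 →
          A.map _ q hm (t m).1 = A.map _ q hn (t n).1 := by
        rintro n _ hn hm rfl
        rw [← ht n (by omega), A.map_map]
      exact key _ _ _ _ (by omega)
    · have key : ∀ n m (hn : p - (n : ℕ) ≤ q) (hm : p - (m : ℕ) ≤ q), m = n →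
          A.map _ q hm (t m).1 = A.map _ q hn (t n).1 := by
        rintro n _ hn hm rfl; rfl
      exact key _ _ _ _ (by omega)
  · have key : ∀ n (hn : p - (n : ℕ) ≤ p), n = 0 → A.map _ p hn (t n).1 = d := by
      rintro _ hn rfl
      exact he' hn
    exact key _ _ (by omega)

theorem toColim_eq_zero_iff (p : ℤ) (s : A.obj p) :
    A.toColim p s = 0 ↔ ∃ (n : ℕ), A.map p (p + n) (by omega) s = 0 := by
  have : DirectedSystem A.obj (fun p q h => A.map p q h) :=
    ⟨fun _ => A.map_self _, fun _ _ _ _ _ => A.map_map _ _ _ _ _⟩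
  constructor
  · intro h
    obtain ⟨q, hpq, hq⟩ := Module.DirectLimit.of.zero_exact h
    refine ⟨(q - p).toNat, ?_⟩
    obtain ⟨r, hr⟩ : ∃ r, r = p + ((q - p).toNat : ℤ) := ⟨_, rfl⟩
    have key : ∀ r (hr : q = r) (h : p ≤ r), A.map p r h s = 0 := by
      rintro _ rfl h; exact hq
    exact key _ (by omega) _
  · rintro ⟨n, hn⟩
    rw [← Module.DirectLimit.of_f (hij := show p ≤ p + (n : ℤ) by omega), hn, map_zero]

/-- The map of colimits induced by a morphism of `ℤ`-diagrams. -/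
def Hom.colimMap {A B : ZDiagram.{u, v} R} (f : Hom A B) : A.colim →ₗ[R] B.colim :=
  Module.DirectLimit.lift R ℤ A.obj A.map (fun p => B.toColim p ∘ₗ f.app p) (by
    intro p q h s
    simp only [LinearMap.comp_apply, f.naturality, Module.DirectLimit.of_f])

theorem Hom.colimMap_toColim {A B : ZDiagram.{u, v} R} (f : Hom A B) (p : ℤ) (s : A.obj p) :
    f.colimMap (A.toColim p s) = B.toColim p (f.app p s) :=
  Module.DirectLimit.lift_of _ _ _

/-- The map of limits induced by a morphism of `ℤ`-diagrams. -/
def Hom.limMap {A B : ZDiagram.{u, v} R} (f : Hom A B) : A.lim →ₗ[R] B.lim :=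
  (LinearMap.pi fun p => f.app p ∘ₗ LinearMap.proj p).restrict (by
    intro s hs
    rw [mem_lim] at hs ⊢
    intro q
    change B.map _ _ _ (f.app _ (s _)) = f.app _ (s _)
    rw [← f.naturality, hs])

end ZDiagram

/-! ### Cycles and boundaries of the spectral sequence in terms of the exact couple -/

namespace BigradedSpectralSequence

variable {R : Type u} [Ring R] {v : ℕ → ℤ × ℤ} (S : BigradedSpectralSequence R v)

theorem mem_cycles_succ (r : ℕ) (x : ℤ × ℤ) (e : S.page 0 x) :
    e ∈ S.cycles (r + 1) x ↔
      ∃ h : e ∈ S.cycles r x, S.d r x (x + v r) rfl (S.toPage r x ⟨e, h⟩) = 0 := by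
  change e ∈ ((LinearMap.ker (S.d r x (x + v r) rfl)).comap (S.toPage r x)).map
    (S.cycles r x).subtype ↔ _
  constructor
  · rintro ⟨e, he, rfl⟩
    exact ⟨e.2, he⟩
  · rintro ⟨h, he⟩
    exact ⟨⟨e, h⟩, he, rfl⟩

theorem homologyIso_toPage_succ (r : ℕ) (x : ℤ × ℤ) (e : S.page 0 x) (h' : e ∈ S.cycles (r + 1) x)
    (h : e ∈ S.cycles r x) (hd : S.d r x (x + v r) rfl (S.toPage r x ⟨e, h⟩) = 0) :
    S.homologyIso r x (S.toPage (r + 1) x ⟨e, h'⟩) =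
      Submodule.Quotient.mk ⟨S.toPage r x ⟨e, h⟩, hd⟩ := by
  rw [← LinearEquiv.eq_symm_apply]
  let K := (LinearMap.ker (S.d r x (x + v r) rfl)).comap (S.toPage r x)
  have : (Submodule.equivMapOfInjective (S.cycles r x).subtype (S.cycles r x).injective_subtype
      K).symm ⟨e, h'⟩ = ⟨⟨e, h⟩, hd⟩ := by
    rw [LinearEquiv.symm_apply_eq]; rfl
  change (S.homologyIso r x).symm (Submodule.mkQ _ ((S.toPage r x).restrict
    (p := K) (q := LinearMap.ker (S.d r x (x + v r) rfl)) (fun _ h => h)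
    ((Submodule.equivMapOfInjective (S.cycles r x).subtype (S.cycles r x).injective_subtype
      K).symm ⟨e, h'⟩))) = _
  rw [this]
  rfl

end BigradedSpectralSequence

namespace ExactCouple

variable {R : Type u} [Ring R] {β : Bidegrees} (C : ExactCouple.{u, v} R β)

/-- The two claims are proved in one induction: the next cycles are cut out by d applied to τ^r e,
so identifying them requires τ^r e to be known as the class of e in Z^r/B^r. -/
theorem spectralSequence_cycles (r : ℕ) (y : ℤ × ℤ) :
    ∀ e : C.E y, (C.toFirstPage y e ∈ C.spectralSequence.cycles r y ↔ e ∈ C.cyclesFin r y) ∧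
      ∀ (h : C.toFirstPage y e ∈ C.spectralSequence.cycles r y) (h' : e ∈ C.cyclesFin r y),
        C.spectralSequence.toPage r y ⟨_, h⟩ = Submodule.Quotient.mk ⟨e, h'⟩ := by
  induction r with
  | zero =>
    intro e
    refine ⟨iff_of_true Submodule.mem_top ?_, fun h h' => rfl⟩
    exact (C.mem_cyclesFin 0 y _ _ rfl (by simp) e).2 ⟨C.k y (y + β.c) rfl e, rfl⟩
  | succ r ih =>
    intro e
    have key : C.toFirstPage y e ∈ C.spectralSequence.cycles (r + 1) y ↔
        e ∈ C.cyclesFin (r + 1) y := by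
      rw [BigradedSpectralSequence.mem_cycles_succ]
      constructor
      · rintro ⟨h, hd⟩
        have h' := (ih e).1.1 h
        rw [(ih e).2 h h'] at hd
        exact (C.ssD_mk_eq_zero_iff r y _ rfl ⟨e, h'⟩).1 hd
      · intro h
        have h' := C.cyclesFin_succ_le r y h
        refine ⟨(ih e).1.2 h', ?_⟩
        rw [(ih e).2 _ h']
        exact (C.ssD_mk_eq_zero_iff r y _ rfl ⟨e, h'⟩).2 h
    refine ⟨key, fun h h' => ?_⟩
    obtain ⟨h₁, hd⟩ := (C.spectralSequence.mem_cycles_succ r y _).1 h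
    -- Elements of the next page are compared in the homology of the present one, where the
    -- isomorphism sends the class of a cycle to its homology class by construction.
    apply (C.spectralSequence.homologyIso r y).injective
    rw [BigradedSpectralSequence.homologyIso_toPage_succ _ r y _ h h₁ hd]
    have h₂ := C.cyclesFin_succ_le r y h'
    have : (⟨C.spectralSequence.toPage r y ⟨_, h₁⟩, hd⟩ :
        LinearMap.ker (C.spectralSequence.d r y _ rfl)) =
        ⟨Submodule.Quotient.mk ⟨e, h₂⟩, (C.ssD_mk_eq_zero_iff r y _ rfl ⟨e, h₂⟩).2 h'⟩ :=
      Subtype.ext ((ih e).2 h₁ h₂)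
    rw [this]
    rfl

theorem mem_cyclesInf {y : ℤ × ℤ} {e : C.E y} : e ∈ C.cyclesInf y ↔ ∀ r, e ∈ C.cyclesFin r y := by
  rw [cyclesInf, Submodule.mem_comap, BigradedSpectralSequence.cyclesInf, Submodule.mem_iInf]
  exact forall_congr' fun r => (C.spectralSequence_cycles r y e).1

theorem toFirstPage_surjective (y : ℤ × ℤ) : Function.Surjective (C.toFirstPage y) := by
  intro q
  obtain ⟨e, rfl⟩ := Submodule.Quotient.mk_surjective _ q
  exact ⟨e, rfl⟩

theorem boundariesFin_le_cyclesFin (r s : ℕ) (y : ℤ × ℤ) :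
    C.boundariesFin r y ≤ C.cyclesFin s y := by
  rintro _ ⟨d, -, rfl⟩
  exact C.j_mem_cyclesFin _ _ _ _ _

theorem mem_spectralSequence_boundaries (r : ℕ) (y : ℤ × ℤ) (e : C.E y) :
    C.toFirstPage y e ∈ C.spectralSequence.boundaries r y ↔ e ∈ C.boundariesFin r y := by
  have key := C.spectralSequence_cycles r y e
  constructor
  · rintro ⟨⟨_, h⟩, hz, rfl⟩
    have h' := key.1.1 h
    exact (Submodule.Quotient.mk_eq_zero
      ((C.boundariesFin r y).submoduleOf (C.cyclesFin r y))).1 ((key.2 h h').symm.trans hz)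
  · intro he
    have h' := C.boundariesFin_le_cyclesFin r r y he
    have h := key.1.2 h'
    exact ⟨⟨_, h⟩, (key.2 h h').trans ((Submodule.Quotient.mk_eq_zero _).2 he), rfl⟩

theorem boundariesFin_mono (y : ℤ × ℤ) : Monotone fun r => C.boundariesFin r y := by
  refine monotone_nat_of_le_succ fun r => ?_
  rintro _ ⟨d, hd, rfl⟩
  refine ⟨d, ?_, rfl⟩
  rw [SetLike.mem_coe, LinearMap.mem_ker] at hd ⊢
  rw [C.iter_succ r _ (y - β.b + r • β.a) _ _ rfl (by rw [succ_nsmul, add_assoc]), hd, map_zero]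

theorem mem_boundariesInf {y : ℤ × ℤ} {e : C.E y} :
    e ∈ C.boundariesInf y ↔ ∃ r, e ∈ C.boundariesFin r y := by
  rw [boundariesInf, Submodule.mem_comap, BigradedSpectralSequence.boundariesInf,
    Submodule.mem_iSup_of_directed]
  · exact exists_congr fun r => C.mem_spectralSequence_boundaries r y e
  -- The supremum is formed in the first page, so its elements are lifted to E, where the boundaries
  -- visibly increase with r.
  · refine Monotone.directed_le fun r s h e he => ?_
    obtain ⟨e, rfl⟩ := C.toFirstPage_surjective y e
    rw [mem_spectralSequence_boundaries] at he ⊢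
    exact C.boundariesFin_mono y h he

end ExactCouple

/-! ### Positions on a line in direction a -/

namespace Bidegrees

variable {β : Bidegrees}

theorem Regular.σ_mul_σ (hβ : β.Regular) : β.σ * β.σ = 1 := by
  rcases hβ with h | h <;> simp [h]

/-- The base point is a multiple of b + c and contributes nothing to the determinant, while p a
contributes σ p. The factor σ in `pos` turns this into p, because σ² = 1. -/
theorem pos_basePoint_add (hβ : β.Regular) (n p : ℤ) :
    β.pos (β.basePoint n + p • β.a) = p := by
  have h := hβ.σ_mul_σ
  have h' : β.pos (β.basePoint n + p • β.a) = β.σ * β.σ * p := by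
    simp only [det₂, basePoint, σ, pos, Prod.fst_add, Prod.snd_add, Prod.smul_fst, Prod.smul_snd,
      smul_eq_mul]
    ring
  rw [h', h, one_mul]

theorem pos_add_nsmul (hβ : β.Regular) (r : ℕ) (x y : ℤ × ℤ) (h : x + r • β.a = y) :
    β.pos y = β.pos x + r := by
  have hσ := hβ.σ_mul_σ
  have h' : β.pos y = β.pos x + β.σ * β.σ * r := by
    rw [← natCast_zsmul] at h
    subst h
    simp only [det₂, σ, pos, Prod.fst_add, Prod.snd_add, Prod.smul_fst, Prod.smul_snd,
      smul_eq_mul]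
    ring
  rw [h', hσ, one_mul]

theorem det_add_zsmul (p : ℤ) (x : ℤ × ℤ) : det₂ β.a (x + p • β.a) = det₂ β.a x := by
  simp only [det₂, Prod.fst_add, Prod.snd_add, Prod.smul_fst, Prod.smul_snd, smul_eq_mul]
  ring

theorem det_add_nsmul (r : ℕ) (x : ℤ × ℤ) : det₂ β.a (x + r • β.a) = det₂ β.a x := by
  rw [← natCast_zsmul, det_add_zsmul]

theorem exists_eq_basePoint_add (hβ : β.Regular) {n : ℤ} {x : ℤ × ℤ} (hx : det₂ β.a x = n) :
    ∃ p : ℤ, β.basePoint n + p • β.a = x :=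
  ⟨β.pos x, basePoint_add_pos hβ n x hx⟩

end Bidegrees

/-! ### The canonical maps of the abutments and their compatibility with i -/

namespace ExactCouple

variable {R : Type u} [Ring R] {β : Bidegrees} (C : ExactCouple.{u, v} R β) (hβ : β.Regular)

theorem i_eq_iter (x y : ℤ × ℤ) (h : x + β.a = y) (h' : x + 1 • β.a = y) (s : C.D x) :
    C.i x y h s = C.iter 1 x y h' s := by
  subst h
  rfl

theorem limMap_basePoint (n p : ℤ) (hx : det₂ β.a (β.basePoint n + p • β.a) = n)
    (s : (C.diagram n).lim) : C.limMap hβ n (β.basePoint n + p • β.a) hx s = s.1 p := by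
  -- The index computed by `pos` equals p only propositionally. Generalizing it to a variable q lets
  -- the substitution remove the transport; the later `key` statements serve the same purpose.
  have key : ∀ q (hq : q = p) (h : β.basePoint n + q • β.a = β.basePoint n + p • β.a),
      C.transport h (s.1 q) = s.1 p := by
    rintro _ rfl h; rfl
  exact key _ (β.pos_basePoint_add hβ n p) _

theorem colimMap_basePoint (n p : ℤ) (hx : det₂ β.a (β.basePoint n + p • β.a) = n)
    (s : C.D (β.basePoint n + p • β.a)) :
    C.colimMap hβ n (β.basePoint n + p • β.a) hx s = (C.diagram n).toColim p s := by
  have key : ∀ q (hq : q = p) (h : β.basePoint n + p • β.a = β.basePoint n + q • β.a),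
      (C.diagram n).toColim q (C.transport h s) = (C.diagram n).toColim p s := by
    rintro _ rfl h; rfl
  exact key _ (β.pos_basePoint_add hβ n p) _

theorem iter_eq_diagram_map (n : ℤ) (r : ℕ) (p q : ℤ) (hpq : p ≤ q) (hr : q - p = r)
    (h : β.basePoint n + p • β.a + r • β.a = β.basePoint n + q • β.a)
    (s : C.D (β.basePoint n + p • β.a)) :
    C.iter r _ _ h s = (C.diagram n).map p q hpq s := by
  obtain rfl : r = (q - p).toNat := by omega
  rfl

theorem iter_limMap (n : ℤ) (r : ℕ) (x y : ℤ × ℤ) (h : x + r • β.a = y) (hx : det₂ β.a x = n)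
    (hy : det₂ β.a y = n) (s : (C.diagram n).lim) :
    C.iter r x y h (C.limMap hβ n x hx s) = C.limMap hβ n y hy s := by
  have hr := β.pos_add_nsmul hβ r x y h
  obtain ⟨p, rfl⟩ := β.exists_eq_basePoint_add hβ hx
  obtain ⟨q, rfl⟩ := β.exists_eq_basePoint_add hβ hy
  rw [β.pos_basePoint_add hβ, β.pos_basePoint_add hβ] at hr
  rw [limMap_basePoint, limMap_basePoint]
  exact (C.iter_eq_diagram_map n r p q (by omega) (by omega) h _).trans
    ((C.diagram n).map_of_mem_lim s.2 p q _)

theorem i_limMap (n : ℤ) (x y : ℤ × ℤ) (h : x + β.a = y) (hx : det₂ β.a x = n)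
    (hy : det₂ β.a y = n) (s : (C.diagram n).lim) :
    C.i x y h (C.limMap hβ n x hx s) = C.limMap hβ n y hy s := by
  rw [C.i_eq_iter x y h (by rw [one_nsmul, h]), C.iter_limMap]

theorem colimMap_iter (n : ℤ) (r : ℕ) (x y : ℤ × ℤ) (h : x + r • β.a = y) (hx : det₂ β.a x = n)
    (hy : det₂ β.a y = n) (s : C.D x) :
    C.colimMap hβ n y hy (C.iter r x y h s) = C.colimMap hβ n x hx s := by
  have hr := β.pos_add_nsmul hβ r x y h
  obtain ⟨p, rfl⟩ := β.exists_eq_basePoint_add hβ hx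
  obtain ⟨q, rfl⟩ := β.exists_eq_basePoint_add hβ hy
  rw [β.pos_basePoint_add hβ, β.pos_basePoint_add hβ] at hr
  rw [colimMap_basePoint, colimMap_basePoint, C.iter_eq_diagram_map n r p q (by omega) (by omega)]
  exact Module.DirectLimit.of_f

theorem colimMap_i (n : ℤ) (x y : ℤ × ℤ) (h : x + β.a = y) (hx : det₂ β.a x = n)
    (hy : det₂ β.a y = n) (s : C.D x) :
    C.colimMap hβ n y hy (C.i x y h s) = C.colimMap hβ n x hx s := by
  rw [C.i_eq_iter x y h (by rw [one_nsmul, h]), C.colimMap_iter]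

/-- In a directed colimit an element vanishes exactly if some transition map kills it; the
transition maps here are the powers of i. -/
theorem colimMap_eq_zero_iff (n : ℤ) (x : ℤ × ℤ) (hx : det₂ β.a x = n) (s : C.D x) :
    C.colimMap hβ n x hx s = 0 ↔ ∃ r, C.iter r x (x + r • β.a) rfl s = 0 := by
  constructor
  · obtain ⟨p, rfl⟩ := β.exists_eq_basePoint_add hβ hx
    intro hs
    obtain ⟨r, hr⟩ := ((C.diagram n).toColim_eq_zero_iff p s).1
      ((C.colimMap_basePoint hβ n p hx s).symm.trans hs)
    refine ⟨r, ?_⟩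
    have key : ∀ z (_ : β.basePoint n + (p + (r : ℤ)) • β.a = z)
          (h : β.basePoint n + p • β.a + r • β.a = z),
        C.iter r _ z h s = 0 := by
      rintro _ rfl h
      exact (C.iter_eq_diagram_map n r p (p + r) (by omega) (by omega) h s).trans hr
    refine key _ ?_ rfl
    rw [add_assoc, ← natCast_zsmul, ← add_zsmul]
  · rintro ⟨r, hr⟩
    rw [← C.colimMap_iter hβ n r x _ rfl hx (by rw [β.det_add_nsmul, hx]), hr, map_zero]

/-- If the sets `I x` are such that every element of `I x` comes from `I (x - a)` along `i`, then
their elements are in the image of the limit abutment. -/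
theorem exists_limMap_eq (I : ∀ x, Set (C.D x))
    (hI : ∀ x y (h : x + β.a = y), ∀ d ∈ I y, ∃ d' ∈ I x, C.i x y h d' = d)
    (n : ℤ) (x : ℤ × ℤ) (hx : det₂ β.a x = n) (d : C.D x) (hd : d ∈ I x) :
    ∃ s, C.limMap hβ n x hx s = d := by
  obtain ⟨p, rfl⟩ := β.exists_eq_basePoint_add hβ hx
  obtain ⟨s, hs, hsp⟩ := (C.diagram n).exists_mem_lim (fun p => I (β.basePoint n + p • β.a))
    (by
      rintro p _ h rfl d hd
      have hp : β.basePoint n + (p - 1) • β.a + β.a = β.basePoint n + p • β.a := by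
        rw [sub_zsmul, one_zsmul]; abel
      obtain ⟨d', hd', rfl⟩ := hI _ _ hp d hd
      refine ⟨d', hd', ?_⟩
      rw [C.i_eq_iter _ _ hp (by rw [one_nsmul, hp])]
      exact (C.iter_eq_diagram_map n 1 (p - 1) p h (by omega) _ d').symm) p d hd
  exact ⟨⟨s, hs⟩, (C.limMap_basePoint hβ n p hx _).trans hsp⟩

/-! #### Stabilization -/

theorem imageSub_zero (x : ℤ × ℤ) : C.imageSub 0 x = ⊤ := by
  rw [imageSub, Ordinal.limitRecOn_zero]

theorem imageSub_add_one (τ : Ordinal.{v}) (x : ℤ × ℤ) :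
    C.imageSub (τ + 1) x =
      (C.imageSub τ (x - β.a)).map (C.i (x - β.a) x (sub_add_cancel x β.a)) := by
  rw [imageSub, Ordinal.limitRecOn_add_one]; rfl

theorem imageSub_limit (τ : Ordinal.{v}) (hτ : Order.IsSuccLimit τ) (x : ℤ × ℤ) :
    C.imageSub τ x = ⨅ (ρ : Ordinal.{v}) (_ : ρ < τ), C.imageSub ρ x := by
  rw [imageSub, Ordinal.limitRecOn_limit _ _ _ _ hτ]; rfl

theorem quotKer_zero (x : ℤ × ℤ) : C.quotKer 0 x = ⊥ := by
  rw [quotKer, Ordinal.limitRecOn_zero]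

theorem quotKer_add_one (τ : Ordinal.{v}) (x : ℤ × ℤ) :
    C.quotKer (τ + 1) x = (C.quotKer τ (x + β.a)).comap (C.i x (x + β.a) rfl) := by
  rw [quotKer, Ordinal.limitRecOn_add_one]; rfl

theorem quotKer_limit (τ : Ordinal.{v}) (hτ : Order.IsSuccLimit τ) (x : ℤ × ℤ) :
    C.quotKer τ x = ⨆ (ρ : Ordinal.{v}) (_ : ρ < τ), C.quotKer ρ x := by
  rw [quotKer, Ordinal.limitRecOn_limit _ _ _ _ hτ]; rfl

theorem mem_imageSub_add_one (τ : Ordinal.{v}) (x y : ℤ × ℤ) (h : x + β.a = y) (d : C.D y) :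
    d ∈ C.imageSub (τ + 1) y ↔ ∃ d' ∈ C.imageSub τ x, C.i x y h d' = d := by
  obtain rfl : x = y - β.a := eq_sub_of_add_eq h
  rw [imageSub_add_one]
  rfl

/-- At a limit stage only the easy inclusion is used: the image of an intersection lies in the
intersection of the images, and these are later stages already known to be smaller. -/
theorem imageSub_add_one_le (τ : Ordinal.{v}) : C.imageSub (τ + 1) ≤ C.imageSub τ := by
  induction τ using Ordinal.limitRecOn with
  | zero => exact fun x => by rw [imageSub_zero]; exact le_top
  | add_one τ ih =>
    intro x
    rw [C.imageSub_add_one (τ + 1), C.imageSub_add_one τ x]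
    exact Submodule.map_mono (ih (x - β.a))
  | limit τ hτ ih =>
    intro x
    rw [imageSub_add_one, C.imageSub_limit τ hτ, C.imageSub_limit τ hτ]
    refine le_iInf₂ fun ρ hρ => le_trans ?_ (ih ρ hρ x)
    rw [imageSub_add_one]
    exact Submodule.map_mono (iInf₂_le ρ hρ)

theorem imageSub_antitone : Antitone C.imageSub := by
  intro ρ τ h
  induction τ using Ordinal.limitRecOn with
  | zero => rw [nonpos_iff_eq_zero.1 h]
  | add_one τ ih =>
    rcases h.eq_or_lt with rfl | h
    · exact le_rfl
    · exact (C.imageSub_add_one_le τ).trans (ih (Order.lt_add_one_iff.1 h))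
  | limit τ hτ ih =>
    rcases h.eq_or_lt with rfl | h
    · exact le_rfl
    · intro x
      rw [C.imageSub_limit τ hτ]
      exact iInf₂_le ρ h

/-- `C.imageSub` takes values in a type of universe `v`, into which the ordinals of that universe do
not inject. Hence two stages agree, and antitonicity makes all stages between them equal. -/
theorem exists_imageSub_add_one_eq : ∃ α : Ordinal.{v}, C.imageSub (α + 1) = C.imageSub α := by
  obtain ⟨ρ, τ, h, hne⟩ : ∃ ρ τ, C.imageSub ρ = C.imageSub τ ∧ ρ ≠ τ := by
    simpa [Function.Injective] using not_injective_of_ordinal.{v} C.imageSub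
  wlog hlt : ρ < τ generalizing ρ τ
  · exact this τ ρ h.symm hne.symm (lt_of_le_of_ne (not_lt.1 hlt) hne.symm)
  exact ⟨ρ, le_antisymm (C.imageSub_add_one_le ρ)
    (h.le.trans (C.imageSub_antitone (Order.add_one_le_of_lt hlt)))⟩

/-- An element in the image of the limit has predecessors that are again in the image of the limit,
because ρ^x = i ∘ ρ^{x-a}. It therefore survives every stage. -/
theorem range_limMap_le_imageSub (n : ℤ) (τ : Ordinal.{v}) (x : ℤ × ℤ) (hx : det₂ β.a x = n) :
    LinearMap.range (C.limMap hβ n x hx) ≤ C.imageSub τ x := by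
  induction τ using Ordinal.limitRecOn generalizing x with
  | zero => rw [imageSub_zero]; exact le_top
  | add_one τ ih =>
    rintro _ ⟨s, rfl⟩
    have hx' : det₂ β.a (x - β.a) = n := by rw [β.det_sub, hx]
    exact (C.mem_imageSub_add_one τ _ x (sub_add_cancel _ _) _).2
      ⟨_, ih (x - β.a) hx' ⟨s, rfl⟩, C.i_limMap hβ n _ _ _ _ _ _⟩
  | limit τ hτ ih =>
    rw [C.imageSub_limit τ hτ]
    exact le_iInf₂ fun ρ hρ => ih ρ hρ x hx

/-- When stage α equals stage α + 1, each element of I^α has a preimage under i in I^α, so it can be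
continued backwards to a compatible family. Later stages are squeezed between I^α and the image of
the limit. -/
theorem exists_imageSub_eq_range : ∃ α : Ordinal.{v}, ∀ τ, α ≤ τ → ∀ n x (hx : det₂ β.a x = n),
    C.imageSub τ x = LinearMap.range (C.limMap hβ n x hx) := by
  obtain ⟨α, hα⟩ := C.exists_imageSub_add_one_eq
  refine ⟨α, fun τ hτ n x hx => le_antisymm ?_ (C.range_limMap_le_imageSub hβ n τ x hx)⟩
  refine (C.imageSub_antitone hτ x).trans fun d hd => ?_
  refine C.exists_limMap_eq hβ (fun x => C.imageSub α x) (fun x y h d hd => ?_) n x hx d hd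
  exact (C.mem_imageSub_add_one α x y h d).1 (hα ▸ hd)

theorem quotKer_le_ker_colimMap (n : ℤ) (τ : Ordinal.{v}) (x : ℤ × ℤ) (hx : det₂ β.a x = n) :
    C.quotKer τ x ≤ LinearMap.ker (C.colimMap hβ n x hx) := by
  induction τ using Ordinal.limitRecOn generalizing x with
  | zero => rw [quotKer_zero]; exact bot_le
  | add_one τ ih =>
    intro s hs
    rw [quotKer_add_one] at hs
    have := ih (x + β.a) (by rw [β.det_add, hx]) hs
    rwa [LinearMap.mem_ker, C.colimMap_i hβ n x _ rfl hx] at this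
  | limit τ hτ ih =>
    rw [C.quotKer_limit τ hτ]
    exact iSup₂_le fun ρ hρ => ih ρ hρ x hx

/-- The induction treats all r ≤ τ together, so monotonicity of `quotKer` is not needed. At a limit
ordinal r < τ, and stage r is one of the terms of the union. -/
theorem ker_iter_le_quotKer (τ : Ordinal.{v}) (r : ℕ) (hr : (r : Ordinal.{v}) ≤ τ) (x y : ℤ × ℤ)
    (h : x + r • β.a = y) (s : C.D x) (hs : C.iter r x y h s = 0) : s ∈ C.quotKer τ x := by
  have zero (x y : ℤ × ℤ) (h : x + 0 • β.a = y) (s : C.D x) (hs : C.iter 0 x y h s = 0) :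
      s = 0 := by
    obtain rfl : x = y := by simpa using h
    exact hs
  induction τ using Ordinal.limitRecOn generalizing x r with
  | zero =>
    obtain rfl : r = 0 := by simpa using hr
    exact zero x y h s hs ▸ zero_mem _
  | add_one τ ih =>
    rcases r with - | r
    · exact zero x y h s hs ▸ zero_mem _
    · have h' : x + β.a + r • β.a = y := by rw [← h, succ_nsmul', add_assoc]
      rw [C.iter_succ' r x _ y h rfl h'] at hs
      rw [quotKer_add_one]
      exact ih r (by simpa using hr) _ h' _ hs
  | limit τ hτ ih =>
    have hr' := Ordinal.natCast_lt_of_isSuccLimit hτ r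
    rw [C.quotKer_limit τ hτ]
    exact (le_iSup₂ (f := fun ρ (_ : ρ < τ) => C.quotKer ρ x) _ hr') (ih _ hr' r le_rfl x h s hs)

/-- Every element of Ker π is killed by a finite power of i and has entered by stage ω. No stage
exceeds Ker π, because π_{x+a} ∘ i = π_x. -/
theorem quotKer_eq_ker_colimMap (n : ℤ) (τ : Ordinal.{v}) (hτ : Ordinal.omega0 ≤ τ) (x : ℤ × ℤ)
    (hx : det₂ β.a x = n) : C.quotKer τ x = LinearMap.ker (C.colimMap hβ n x hx) := by
  refine le_antisymm (C.quotKer_le_ker_colimMap hβ n τ x hx) fun s hs => ?_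
  obtain ⟨r, hr⟩ := (C.colimMap_eq_zero_iff hβ n x hx s).1 hs
  exact C.ker_iter_le_quotKer τ r ((Ordinal.natCast_lt_omega0 r).le.trans hτ) x _ rfl s hr

/-- From some ordinal on, the cycles are `k⁻¹ (Im ρ)` and the boundaries are `j (Ker π)`. -/
theorem exists_stable : ∃ α : Ordinal.{v}, ∀ τ, α ≤ τ → ∀ y,
    C.cyclesOrd τ y =
      (LinearMap.range (C.limMap hβ _ (y + β.c) rfl)).comap (C.k y (y + β.c) rfl) ∧
    C.boundariesOrd τ y =
      (LinearMap.ker (C.colimMap hβ _ (y - β.b) rfl)).map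
        (C.j (y - β.b) y (sub_add_cancel y β.b)) := by
  obtain ⟨α, hα⟩ := C.exists_imageSub_eq_range hβ
  refine ⟨max α Ordinal.omega0, fun τ hτ y => ⟨?_, ?_⟩⟩
  · rw [cyclesOrd, hα τ ((le_max_left _ _).trans hτ)]
  · rw [boundariesOrd, C.quotKer_eq_ker_colimMap hβ _ τ ((le_max_right _ _).trans hτ)]

theorem exists_isStable (hβ : β.Regular) : ∃ α, C.IsStable α := by
  obtain ⟨α, hα⟩ := C.exists_stable hβ
  refine ⟨α, fun τ hτ y => ⟨?_, ?_⟩⟩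
  · rw [(hα τ hτ y).1, (hα α le_rfl y).1]
  · rw [(hα τ hτ y).2, (hα α le_rfl y).2]

theorem stable_eq (y : ℤ × ℤ) :
    C.cyclesStable y =
      (LinearMap.range (C.limMap hβ _ (y + β.c) rfl)).comap (C.k y (y + β.c) rfl) ∧
    C.boundariesStable y =
      (LinearMap.ker (C.colimMap hβ _ (y - β.b) rfl)).map
        (C.j (y - β.b) y (sub_add_cancel y β.b)) := by
  obtain ⟨α, hα⟩ := C.exists_stable hβ
  -- Ordinals are well-ordered, so the infimum of the nonempty set of stability ordinals belongs to
  -- it. The explicit formulas are then read off at the maximum with α.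
  have h : C.IsStable C.stableOrd := csInf_mem (C.exists_isStable hβ)
  have h₁ := h _ (le_max_left _ α) y
  have h₂ := hα _ (le_max_right C.stableOrd α) y
  exact ⟨h₁.1.symm.trans h₂.1, h₁.2.symm.trans h₂.2⟩

theorem mem_cyclesStable (n : ℤ) (y z : ℤ × ℤ) (h : y + β.c = z) (hz : det₂ β.a z = n)
    (e : C.E y) : e ∈ C.cyclesStable y ↔ ∃ s, C.limMap hβ n z hz s = C.k y z h e := by
  subst h hz
  rw [(C.stable_eq hβ y).1]
  rfl

theorem mem_boundariesInf_iff (n : ℤ) (x y : ℤ × ℤ) (h : x + β.b = y) (hx : det₂ β.a x = n)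
    (e : C.E y) : e ∈ C.boundariesInf y ↔ ∃ s, C.colimMap hβ n x hx s = 0 ∧ C.j x y h s = e := by
  simp only [C.mem_boundariesInf, C.mem_boundariesFin _ y x _ h rfl, C.colimMap_eq_zero_iff]
  constructor
  · rintro ⟨r, s, h, h'⟩; exact ⟨s, ⟨r, h⟩, h'⟩
  · rintro ⟨s, ⟨r, h⟩, h'⟩; exact ⟨r, s, h, h'⟩

/-- Both sides are j(Ker π). This is why passing from Ē to E^∞ loses nothing. -/
theorem boundariesStable_eq (hβ : β.Regular) (y : ℤ × ℤ) : C.boundariesStable y = C.boundariesInf y := by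
  ext e
  rw [(C.stable_eq hβ y).2, C.mem_boundariesInf_iff hβ _ _ y (sub_add_cancel y β.b) rfl]
  rfl

end ExactCouple

/-! ### Elements of the pointwise kernel diagrams -/

namespace ZDiagram

variable {R : Type u} [Ring R] (A : ZDiagram.{u, v} R)

theorem map_kernelDiagram_eq_zero (q : ℤ) {p r : ℤ} (hp : p ≤ r) (hq : q ≤ r)
    (s : (A.kernelDiagram q).obj p) : A.map p r hp s.1 = 0 := by
  rw [← A.map_map p (max p q) r (le_max_left p q) (max_le hp hq), LinearMap.mem_ker.1 s.2, map_zero]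

theorem eq_zero_of_le (q : ℤ) {p : ℤ} (hq : q ≤ p) (s : (A.kernelDiagram q).obj p) : s.1 = 0 := by
  rw [← A.map_self p s.1]
  exact A.map_kernelDiagram_eq_zero q le_rfl hq s

theorem mem_ker_of_map_eq_zero {p q : ℤ} (h : p ≤ q) {s : A.obj p} (hs : A.map p q h s = 0) :
    s ∈ LinearMap.ker (A.map p (max p q) (le_max_left p q)) := by
  have key : ∀ r (_ : q = r) (h : p ≤ r), A.map p r h s = 0 := by
    rintro _ rfl h; exact hs
  exact key _ (max_eq_right h).symm _

theorem val_limDiff_kernelDiagram (q : ℤ) (y : ∀ p, (A.kernelDiagram q).obj p) (p : ℤ) :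
    ((A.kernelDiagram q).limDiff y p).1 = (y p).1 - A.map (p - 1) p (by omega) (y (p - 1)).1 := rfl

end ZDiagram

namespace ExactCouple

variable {R : Type u} [Ring R] {β : Bidegrees} (C : ExactCouple.{u, v} R β) (hβ : β.Regular)

/-! #### Inclusions -/

theorem colimStagePrev_le (x : ℤ × ℤ) : C.colimStagePrev hβ x ≤ C.colimStage hβ x := by
  rintro _ ⟨s, rfl⟩
  exact ⟨C.i _ x (sub_add_cancel _ _) s, C.colimMap_i hβ _ _ _ _ _ _ s⟩

theorem limStage_le (w : ℤ × ℤ) : C.limStage hβ w ≤ C.limStageNext hβ w := by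
  intro s hs
  refine LinearMap.mem_ker.2 ?_
  rw [← C.i_limMap hβ _ w (w + β.a) rfl rfl, LinearMap.mem_ker.1 hs, map_zero]

theorem boundariesInf_le (y : ℤ × ℤ) : C.boundariesInf y ≤ C.cyclesInf y := by
  intro e he
  obtain ⟨r, hr⟩ := C.mem_boundariesInf.1 he
  exact C.mem_cyclesInf.2 fun s => C.boundariesFin_le_cyclesFin r s y hr

theorem rangeJ_le (x : ℤ × ℤ) : C.rangeJ x ≤ C.cyclesInf (x + β.b) := by
  rintro _ ⟨s, rfl⟩
  exact C.mem_cyclesInf.2 fun r => C.j_mem_cyclesFin r _ _ _ s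

theorem j_mem_cyclesInf (x : ℤ × ℤ) (s : C.D x) : C.j x _ rfl s ∈ C.cyclesInf (x + β.b) :=
  C.rangeJ_le x (LinearMap.mem_range_self _ s)

/-- An element in the image of the limit is an r-fold image for every r: ρ^z = i^r ∘ ρ^{z-ra}. -/
theorem mem_cyclesInf_of_limMap_eq {n : ℤ} {y z : ℤ × ℤ} {h : y + β.c = z} {hz : det₂ β.a z = n}
    {e : C.E y} {s : (C.diagram n).lim} (hs : C.limMap hβ n z hz s = C.k y z h e) :
    e ∈ C.cyclesInf y := by
  refine C.mem_cyclesInf.2 fun r => ?_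
  have hr : z - r • β.a + r • β.a = z := sub_add_cancel _ _
  have hd : det₂ β.a (z - r • β.a) = n := by rw [← β.det_add_nsmul r, hr, hz]
  exact (C.mem_cyclesFin r y (z - r • β.a) z h hr e).2
    ⟨C.limMap hβ n _ hd s, by rw [C.iter_limMap hβ n r _ z hr hd hz, hs]⟩

theorem cyclesStable_le (hβ : β.Regular) (y : ℤ × ℤ) : C.cyclesStable y ≤ C.cyclesInf y := by
  intro e he
  obtain ⟨s, hs⟩ := (C.mem_cyclesStable hβ _ y _ rfl rfl e).1 he
  exact C.mem_cyclesInf_of_limMap_eq hβ hs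

theorem boundariesStable_le (hβ : β.Regular) (y : ℤ × ℤ) :
    C.boundariesStable y ≤ C.cyclesStable y := by
  intro e he
  rw [C.boundariesStable_eq hβ, C.mem_boundariesInf_iff hβ _ _ y (sub_add_cancel y β.b) rfl] at he
  obtain ⟨d, -, rfl⟩ := he
  refine (C.mem_cyclesStable hβ _ y _ rfl rfl _).2 ⟨0, ?_⟩
  rw [map_zero]
  exact ((C.exact_jk _ y _ _ rfl).apply_apply_eq_zero d).symm

theorem boundariesInf_le_rangeJ (x : ℤ × ℤ) : C.boundariesInf (x + β.b) ≤ C.rangeJ x := by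
  intro e he
  obtain ⟨r, hr⟩ := C.mem_boundariesInf.1 he
  obtain ⟨s, -, hs⟩ := (C.mem_boundariesFin r _ x _ rfl rfl e).1 hr
  exact ⟨s, hs⟩

theorem mem_rangeJ {x w : ℤ × ℤ} (h : x + β.b + β.c = w) {e : C.E (x + β.b)} :
    e ∈ C.rangeJ x ↔ C.k _ w h e = 0 :=
  (C.exact_jk x _ w rfl h e).symm

/-! #### The rows -/

/-- The projection `D x → L_x / L_{x - a}`. -/
def toColimQuot (x : ℤ × ℤ) : C.D x →ₗ[R] C.colimQuot hβ x :=
  Submodule.mkQ _ ∘ₗ (C.colimMap hβ _ x rfl).rangeRestrict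

theorem toColimQuot_surjective (x : ℤ × ℤ) : Function.Surjective (C.toColimQuot hβ x) :=
  (Submodule.mkQ_surjective _).comp (LinearMap.surjective_rangeRestrict _)

/-- The map `D x → E^∞_{x + b}` induced by `j`. -/
def jInf (x : ℤ × ℤ) : C.D x →ₗ[R] C.eInf (x + β.b) :=
  Submodule.mkQ _ ∘ₗ (C.j x _ rfl).codRestrict _ (C.j_mem_cyclesInf x)

/-- Both conditions say that s lies in Im i + Ker π_x: on the left because π_{x-a} = π_x ∘ i, on the
right because B^∞ = j(Ker π_x) and Ker j = Im i. -/
theorem toColimQuot_eq_zero_iff (x : ℤ × ℤ) (s : C.D x) :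
    C.toColimQuot hβ x s = 0 ↔ C.jInf x s = 0 := by
  have h₁ : C.toColimQuot hβ x s = 0 ↔ C.colimMap hβ _ x rfl s ∈ C.colimStagePrev hβ x :=
    Submodule.Quotient.mk_eq_zero _
  have h₂ : C.jInf x s = 0 ↔ C.j x _ rfl s ∈ C.boundariesInf (x + β.b) :=
    Submodule.Quotient.mk_eq_zero _
  have ha : x - β.a + β.a = x := sub_add_cancel _ _
  rw [h₁, h₂, C.mem_boundariesInf_iff hβ _ x _ rfl rfl]
  constructor
  · rintro ⟨d, hd⟩
    refine ⟨s - C.i _ x ha d, ?_, ?_⟩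
    · rw [map_sub, C.colimMap_i hβ _ _ x ha (β.det_sub x), hd, sub_self]
    · rw [map_sub, (C.exact_ij _ x _ ha rfl).apply_apply_eq_zero, sub_zero]
  · rintro ⟨d, hd, hj⟩
    obtain ⟨d', hd'⟩ := (C.exact_ij _ x _ ha rfl (s - d)).1 (by rw [map_sub, hj, sub_self])
    refine ⟨d', ?_⟩
    rw [← C.colimMap_i hβ _ _ x ha (β.det_sub x) rfl, hd', map_sub, hd, sub_zero]

/-- The map `L_x / L_{x - a} → E^∞_{x + b}` sending the class of `π_x s` to the class of `j s`. -/
def botIncl (x : ℤ × ℤ) : C.colimQuot hβ x →ₗ[R] C.eInf (x + β.b) :=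
  LinearMap.relLift LinearMap.id (C.toColimQuot hβ x) (C.jInf x) (C.toColimQuot_surjective hβ x)
    fun s hs => (C.toColimQuot_eq_zero_iff hβ x s).1 hs

theorem botIncl_toColimQuot (x : ℤ × ℤ) (s : C.D x) :
    C.botIncl hβ x (C.toColimQuot hβ x s) = C.jInf x s :=
  LinearMap.relLift_eq rfl

theorem botIncl_injective (x : ℤ × ℤ) : Function.Injective (C.botIncl hβ x) := by
  rw [injective_iff_map_eq_zero]
  intro q hq
  obtain ⟨s, rfl⟩ := C.toColimQuot_surjective hβ x q
  rw [botIncl_toColimQuot] at hq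
  exact (C.toColimQuot_eq_zero_iff hβ x s).2 hq

/-- The projection `E^∞_{x + b} → Z^∞_{x + b} / Im j_x`. -/
def botProj (x : ℤ × ℤ) : C.eInf (x + β.b) →ₗ[R] C.cyclesQuot x :=
  Submodule.mapQ _ _ LinearMap.id fun _ h => C.boundariesInf_le_rangeJ x h

theorem botProj_surjective (x : ℤ × ℤ) : Function.Surjective (C.botProj x) := by
  intro q
  obtain ⟨z, rfl⟩ := Submodule.Quotient.mk_surjective _ q
  exact ⟨Submodule.Quotient.mk z, rfl⟩

theorem bot_exact (x : ℤ × ℤ) : Function.Exact (C.botIncl hβ x) (C.botProj x) := by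
  intro e
  obtain ⟨z, rfl⟩ := Submodule.Quotient.mk_surjective _ e
  have h : C.botProj x (Submodule.Quotient.mk z) = 0 ↔ z.1 ∈ C.rangeJ x :=
    Submodule.Quotient.mk_eq_zero _
  rw [h]
  constructor
  · rintro ⟨s, hs⟩
    refine ⟨C.toColimQuot hβ x s, ?_⟩
    rw [botIncl_toColimQuot]
    exact congrArg Submodule.Quotient.mk (Subtype.ext hs)
  · rintro ⟨q, hq⟩
    obtain ⟨s, rfl⟩ := C.toColimQuot_surjective hβ x q
    rw [botIncl_toColimQuot] at hq
    have : C.botProj x (C.jInf x s) = 0 :=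
      (Submodule.Quotient.mk_eq_zero _).2 (LinearMap.mem_range_self _ s)
    rw [← h, ← hq, this]

/-- The map `Ē_y → E^∞_y` induced by the inclusion of the stable cycles. -/
def stableToInf (hβ : β.Regular) (y : ℤ × ℤ) : C.eStable y →ₗ[R] C.eInf y :=
  Submodule.mapQ _ _ (Submodule.inclusion (C.cyclesStable_le hβ y))
    fun _ h => (C.boundariesStable_eq hβ y).le h

theorem stableToInf_injective (hβ : β.Regular) (y : ℤ × ℤ) :
    Function.Injective (C.stableToInf hβ y) := by
  rw [injective_iff_map_eq_zero]
  intro e he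
  obtain ⟨z, rfl⟩ := Submodule.Quotient.mk_surjective _ e
  have h : z.1 ∈ C.boundariesInf y := (Submodule.Quotient.mk_eq_zero
    ((C.boundariesInf y).submoduleOf (C.cyclesInf y))).1 he
  exact (Submodule.Quotient.mk_eq_zero _).2 ((C.boundariesStable_eq hβ y).ge h)

/-- The map `k : Z^∞_{x + b} → D w`, where `w = x + b + c`. -/
def kInf (x : ℤ × ℤ) : C.cyclesInf (x + β.b) →ₗ[R] C.D (x + β.b + β.c) :=
  C.k (x + β.b) (x + β.b + β.c) rfl ∘ₗ Submodule.subtype _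

/-- The restriction of `ρ^w` to `L^{w + a}`. -/
def limMapNext (w : ℤ × ℤ) : C.limStageNext hβ w →ₗ[R] C.D w :=
  C.limMap hβ _ w rfl ∘ₗ Submodule.subtype _

/-- Membership in L^{w+a} says that i kills ρ^w(s), so exactness gives z with k(z) = ρ^w(s). Such a
z is automatically an infinite cycle. -/
theorem limMapNext_mem_range (x : ℤ × ℤ) (s : C.limStageNext hβ (x + β.b + β.c)) :
    C.limMapNext hβ _ s ∈ LinearMap.range (C.kInf x) := by
  obtain ⟨z, hz⟩ := (C.exact_ki (x + β.b) _ _ rfl rfl (C.limMapNext hβ _ s)).1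
    ((C.i_limMap hβ _ _ _ rfl rfl (β.det_add _) s.1).trans s.2)
  exact ⟨⟨z, C.mem_cyclesInf_of_limMap_eq hβ (hz := rfl) hz.symm⟩, hz⟩

theorem kInf_eq_zero_iff (x : ℤ × ℤ) (z : C.cyclesInf (x + β.b)) :
    C.kInf x z = 0 ↔ (Submodule.Quotient.mk z : C.cyclesQuot x) = 0 := by
  have h : (Submodule.Quotient.mk z : C.cyclesQuot x) = 0 ↔ z.1 ∈ C.rangeJ x :=
    Submodule.Quotient.mk_eq_zero _
  rw [h, C.mem_rangeJ rfl]
  rfl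

/-- The map `t : L^{w + a} → Z^∞_{x + b} / Im j_x`, where `w = x + b + c`. -/
def limToCycles (x : ℤ × ℤ) :
    C.limStageNext hβ (x + β.b + β.c) →ₗ[R] C.cyclesQuot x :=
  LinearMap.relLift (C.limMapNext hβ _) (C.kInf x) (Submodule.mkQ _) (C.limMapNext_mem_range hβ x)
    fun z => (C.kInf_eq_zero_iff x z).1

theorem limToCycles_apply {x : ℤ × ℤ} {s : C.limStageNext hβ (x + β.b + β.c)}
    {z : C.cyclesInf (x + β.b)} (h : C.limMapNext hβ _ s = C.kInf x z) :
    C.limToCycles hβ x s = Submodule.Quotient.mk z :=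
  LinearMap.relLift_eq h

theorem limToCycles_eq_zero_iff (x : ℤ × ℤ) (s : C.limStageNext hβ (x + β.b + β.c)) :
    C.limToCycles hβ x s = 0 ↔ s.1 ∈ C.limStage hβ (x + β.b + β.c) := by
  obtain ⟨z, hz⟩ := C.limMapNext_mem_range hβ x s
  rw [C.limToCycles_apply hβ hz.symm, ← C.kInf_eq_zero_iff, hz]
  exact Iff.rfl

/-- The map `M : L^{w + a} / L^w → Z^∞_{x + b} / Im j_x`, where `w = x + b + c`. -/
def limQuotToCycles (x : ℤ × ℤ) : C.limQuot hβ (x + β.b + β.c) →ₗ[R] C.cyclesQuot x :=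
  Submodule.liftQ _ (C.limToCycles hβ x) fun s hs => (C.limToCycles_eq_zero_iff hβ x s).2 hs

theorem limQuotToCycles_injective (x : ℤ × ℤ) : Function.Injective (C.limQuotToCycles hβ x) := by
  rw [injective_iff_map_eq_zero]
  intro l hl
  obtain ⟨s, rfl⟩ := Submodule.Quotient.mk_surjective _ l
  exact (Submodule.Quotient.mk_eq_zero _).2 ((C.limToCycles_eq_zero_iff hβ x s).1 hl)

theorem mk_mem_range_limToCycles_iff (x : ℤ × ℤ) (z : C.cyclesInf (x + β.b)) :
    (∃ s, C.limToCycles hβ x s = Submodule.Quotient.mk z) ↔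
      ∃ s, C.limMap hβ _ (x + β.b + β.c) rfl s = C.kInf x z := by
  constructor
  · rintro ⟨s, hs⟩
    obtain ⟨z', hz'⟩ := C.limMapNext_mem_range hβ x s
    refine ⟨s.1, Eq.trans hz'.symm ?_⟩
    rw [C.limToCycles_apply hβ hz'.symm, ← sub_eq_zero, ← Submodule.Quotient.mk_sub,
      ← C.kInf_eq_zero_iff, map_sub, sub_eq_zero] at hs
    exact hs
  · rintro ⟨s, hs⟩
    -- Membership in L^{w+a} is automatic here, because i ∘ k = 0.
    have h : s ∈ C.limStageNext hβ (x + β.b + β.c) := by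
      refine LinearMap.mem_ker.2 ?_
      rw [← C.i_limMap hβ _ _ _ rfl rfl, hs]
      exact (C.exact_ki _ _ _ rfl rfl).apply_apply_eq_zero _
    exact ⟨⟨s, h⟩, C.limToCycles_apply hβ hs⟩

/-- This carries the pullback property: the image of M consists of the classes of stable cycles, so
its preimage in E^∞ is the image of Ē. -/
theorem botProj_mem_range_iff (x : ℤ × ℤ) (e : C.eInf (x + β.b)) :
    C.botProj x e ∈ LinearMap.range (C.limQuotToCycles hβ x) ↔
      e ∈ LinearMap.range (C.stableToInf hβ (x + β.b)) := by
  obtain ⟨z, rfl⟩ := Submodule.Quotient.mk_surjective _ e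
  have h : C.botProj x (Submodule.Quotient.mk z) ∈ LinearMap.range (C.limQuotToCycles hβ x) ↔
      ∃ s, C.limToCycles hβ x s = Submodule.Quotient.mk z := by
    constructor
    · rintro ⟨l, hl⟩
      obtain ⟨s, rfl⟩ := Submodule.Quotient.mk_surjective _ l
      exact ⟨s, hl⟩
    · rintro ⟨s, hs⟩
      exact ⟨Submodule.Quotient.mk s, hs⟩
  have h' := C.mem_cyclesStable hβ _ _ (x + β.b + β.c) rfl rfl z.1
  rw [h, mk_mem_range_limToCycles_iff]
  refine h'.symm.trans ?_
  constructor
  · intro hz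
    exact ⟨Submodule.Quotient.mk ⟨z.1, hz⟩, rfl⟩
  · rintro ⟨q, hq⟩
    obtain ⟨z', rfl⟩ := Submodule.Quotient.mk_surjective _ q
    -- A representative that agrees with a stable cycle modulo B^∞ is itself stable, since B^∞
    -- consists of stable boundaries and these are stable cycles.
    have hq' : z'.1 - z.1 ∈ C.boundariesInf (x + β.b) := (Submodule.Quotient.eq
      ((C.boundariesInf (x + β.b)).submoduleOf (C.cyclesInf (x + β.b)))).1 hq
    have := sub_mem z'.2 (C.boundariesStable_le hβ _ ((C.boundariesStable_eq hβ _).ge hq'))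
    rwa [sub_sub_cancel] at this

/-- The projection `Ē_{x + b} → L^{w + a} / L^w`, where `w = x + b + c`. -/
def topProj (x : ℤ × ℤ) : C.eStable (x + β.b) →ₗ[R] C.limQuot hβ (x + β.b + β.c) :=
  (C.limQuotToCycles hβ x).liftInjective (C.botProj x ∘ₗ C.stableToInf hβ (x + β.b))
    (C.limQuotToCycles_injective hβ x)
    fun e => (C.botProj_mem_range_iff hβ x _).2 (LinearMap.mem_range_self _ e)

theorem limQuotToCycles_topProj (x : ℤ × ℤ) (e : C.eStable (x + β.b)) :
    C.limQuotToCycles hβ x (C.topProj hβ x e) = C.botProj x (C.stableToInf hβ _ e) :=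
  LinearMap.apply_liftInjective _ _ _ _ e

/-- The map `L_x / L_{x - a} → Ē_{x + b}`. -/
def topIncl (x : ℤ × ℤ) : C.colimQuot hβ x →ₗ[R] C.eStable (x + β.b) :=
  (C.stableToInf hβ (x + β.b)).liftInjective (C.botIncl hβ x) (C.stableToInf_injective hβ _)
    fun q => by
      rw [← C.botProj_mem_range_iff, (C.bot_exact hβ x).apply_apply_eq_zero]
      exact zero_mem _

theorem stableToInf_topIncl (x : ℤ × ℤ) (q : C.colimQuot hβ x) :
    C.stableToInf hβ _ (C.topIncl hβ x q) = C.botIncl hβ x q :=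
  LinearMap.apply_liftInjective _ _ _ _ q

theorem topIncl_injective (x : ℤ × ℤ) : Function.Injective (C.topIncl hβ x) := by
  intro q q' h
  apply C.botIncl_injective hβ x
  rw [← stableToInf_topIncl, h, stableToInf_topIncl]

/-- Both vertical maps are injective, so exactness can be tested in the bottom row. -/
theorem top_exact (x : ℤ × ℤ) : Function.Exact (C.topIncl hβ x) (C.topProj hβ x) := by
  intro e
  rw [← (C.limQuotToCycles_injective hβ x).eq_iff, limQuotToCycles_topProj, map_zero,
    C.bot_exact hβ x]
  refine exists_congr fun q => ?_
  rw [← stableToInf_topIncl, (C.stableToInf_injective hβ _).eq_iff]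

theorem exists_pullback (x : ℤ × ℤ) (e : C.eInf (x + β.b)) (l : C.limQuot hβ (x + β.b + β.c))
    (h : C.botProj x e = C.limQuotToCycles hβ x l) :
    ∃! s, C.stableToInf hβ _ s = e ∧ C.topProj hβ x s = l := by
  obtain ⟨s, rfl⟩ := (C.botProj_mem_range_iff hβ x e).1 (h ▸ LinearMap.mem_range_self _ l)
  refine ⟨s, ⟨rfl, C.limQuotToCycles_injective hβ x ?_⟩,
    fun s' hs' => C.stableToInf_injective hβ _ hs'.1⟩
  rw [limQuotToCycles_topProj, h]

theorem topProj_surjective (x : ℤ × ℤ) : Function.Surjective (C.topProj hβ x) := by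
  intro l
  obtain ⟨e, he⟩ := C.botProj_surjective x (C.limQuotToCycles hβ x l)
  obtain ⟨s, hs, -⟩ := C.exists_pullback hβ x e l he
  exact ⟨s, hs.2⟩

end ExactCouple

namespace ExactCouple

variable {R : Type u} [Ring R] {β : Bidegrees} (C : ExactCouple.{u, v} R β) (hβ : β.Regular)

/-! #### The connecting homomorphism -/

theorem limMap_mem_column_lim (n : ℤ) (w : ℤ × ℤ) (hw : ∀ p : ℤ, det₂ β.a (w + p • β.a) = n)
    (s : (C.diagram n).lim) :
    (fun p => C.limMap hβ n (w + p • β.a) (hw p) s) ∈ (C.column w).lim :=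
  (C.column w).mem_lim.2 fun _ => C.iter_limMap hβ n _ _ _ _ _ _ s

/-- The column through w and D(n) differ by a shift. Instead of an isomorphism between their limits,
only the coordinates of s' are used: each is the image under i of the preceding one, so each comes
from the limit abutment. -/
theorem exists_limMap_eq_of_mem_column_lim (n : ℤ) (w : ℤ × ℤ) {s' : ∀ p, (C.column w).obj p}
    (hs' : s' ∈ (C.column w).lim) (p : ℤ) (hp : det₂ β.a (w + p • β.a) = n) :
    ∃ s, C.limMap hβ n (w + p • β.a) hp s = s' p := by
  refine C.exists_limMap_eq hβ
    (fun x => {d | ∃ (p : ℤ) (h : w + p • β.a = x), C.transport h (s' p) = d}) ?_ n _ hp (s' p)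
    ⟨p, rfl, rfl⟩
  rintro x _ h _ ⟨p, rfl, rfl⟩
  have hx : w + (p - 1) • β.a = x := by
    rw [sub_zsmul, one_zsmul, ← add_assoc, ← h, add_neg_cancel_right]
  subst hx
  refine ⟨s' (p - 1), ⟨p - 1, rfl, rfl⟩, ?_⟩
  refine (C.i_eq_iter _ _ h (by rw [one_nsmul, h]) _).trans ?_
  have key : ∀ r (_ : r = 1) (h : w + (p - 1) • β.a + r • β.a = w + p • β.a)
      (h' : w + (p - 1) • β.a + 1 • β.a = w + p • β.a) (d : C.D (w + (p - 1) • β.a)),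
      C.iter 1 _ _ h' d = C.iter r _ _ h d := by
    rintro _ rfl _ _ _; rfl
  exact (key (p - (p - 1)).toNat (by omega) (column_aux w (p - 1) p (by omega)) _ _).trans
    ((C.column w).mem_lim.1 hs' p)

/-- The map `k : Z^∞_{x + b} → D w` as a map to position `0` of the column through `w`, where
`w = x + b + c`. -/
def kColumn (x : ℤ × ℤ) :
    C.cyclesInf (x + β.b) →ₗ[R] (C.column (x + β.b + β.c)).obj 0 :=
  C.k (x + β.b) (x + β.b + β.c + (0 : ℤ) • β.a) (by simp) ∘ₗ Submodule.subtype _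

theorem kColumn_eq_iff (x : ℤ × ℤ) (n : ℤ) (z : C.cyclesInf (x + β.b))
    (h : det₂ β.a (x + β.b + β.c + (0 : ℤ) • β.a) = n) (h' : det₂ β.a (x + β.b + β.c) = n)
    (s : (C.diagram n).lim) :
    C.limMap hβ n (x + β.b + β.c + (0 : ℤ) • β.a) h s = C.kColumn x z ↔
      C.limMap hβ n (x + β.b + β.c) h' s = C.kInf x z := by
  have key : ∀ w (_ : x + β.b + β.c = w) (h : det₂ β.a w = n) (hk : x + β.b + β.c = w),
      C.limMap hβ n w h s = C.k (x + β.b) w hk z.1 ↔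
      C.limMap hβ n (x + β.b + β.c) h' s = C.kInf x z := by
    rintro _ rfl _ _; rfl
  exact key _ (by simp) h (by simp)

theorem kColumn_eq_zero_iff (x : ℤ × ℤ) (z : C.cyclesInf (x + β.b)) :
    C.kColumn x z = 0 ↔ (Submodule.Quotient.mk z : C.cyclesQuot x) = 0 := by
  have h : (Submodule.Quotient.mk z : C.cyclesQuot x) = 0 ↔ z.1 ∈ C.rangeJ x :=
    Submodule.Quotient.mk_eq_zero _
  rw [h, C.mem_rangeJ (w := x + β.b + β.c + (0 : ℤ) • β.a) (by simp)]
  rfl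

theorem map_zero_one_kColumn (x : ℤ × ℤ) (z : C.cyclesInf (x + β.b)) :
    (C.column (x + β.b + β.c)).map 0 1 zero_le_one (C.kColumn x z) = 0 := by
  have h : x + β.b + β.c + (0 : ℤ) • β.a + β.a = x + β.b + β.c + (1 : ℤ) • β.a := by simp
  have := (C.exact_ki (x + β.b) _ _ (by simp) h).apply_apply_eq_zero z.1
  rwa [C.i_eq_iter _ _ h (by simp)] at this

/-- Together with `map_zero_one_kColumn` and `exists_map_eq_kColumn` this gives k(Z^∞) = Ker i ∩ ⋂
Im i^r, the limit of the third tower. -/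
theorem exists_kColumn_eq (x : ℤ × ℤ)
    (d : (C.column (x + β.b + β.c)).obj 0)
    (hd : ∀ (p : ℤ) (hp : p ≤ 0), ∃ s, (C.column (x + β.b + β.c)).map p 0 hp s = d)
    (hd' : (C.column (x + β.b + β.c)).map 0 1 zero_le_one d = 0) :
    ∃ z, C.kColumn x z = d := by
  have h : x + β.b + β.c + (0 : ℤ) • β.a + β.a = x + β.b + β.c + (1 : ℤ) • β.a := by simp
  obtain ⟨z, hz⟩ := (C.exact_ki (x + β.b) _ _ (by simp) h d).1
    ((C.i_eq_iter _ _ h (by simp) d).trans hd')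
  refine ⟨⟨z, C.mem_cyclesInf.2 fun r => ?_⟩, hz⟩
  obtain ⟨s, hs⟩ := hd (-r) (by omega)
  have hr : x + β.b + β.c + (-(r : ℤ)) • β.a + r • β.a = x + β.b + β.c + (0 : ℤ) • β.a := by
    simp
  refine (C.mem_cyclesFin r _ _ _ (by simp) hr z).2 ⟨s, ?_⟩
  rw [hz, ← hs]
  have key : ∀ t (_ : t = r) (h : x + β.b + β.c + (-(r : ℤ)) • β.a + t • β.a =
      x + β.b + β.c + (0 : ℤ) • β.a), C.iter r _ _ hr s = C.iter t _ _ h s := by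
    rintro _ rfl _; rfl
  exact key _ (by omega) _

theorem exists_map_eq_kColumn (x : ℤ × ℤ) (z : C.cyclesInf (x + β.b)) (p : ℤ) (hp : p ≤ 0) :
    ∃ s, (C.column (x + β.b + β.c)).map p 0 hp s = C.kColumn x z :=
  (C.mem_cyclesFin (0 - p).toNat _ (x + β.b + β.c + p • β.a) _ (by simp)
    (column_aux _ p 0 hp) z.1).1 (C.mem_cyclesInf.1 z.2 _)

/-- The triples `(z, y, u)` which define the connecting homomorphism: the family `y` consists of
lifts of `k z`, and `u` is the family of differences `y_q - i (y_{q-1})`. -/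
def connectingRel (x : ℤ × ℤ) : Submodule R (C.cyclesInf (x + β.b) ×
    (∀ p, ((C.column (x + β.b + β.c)).kernelDiagram 1).obj p) ×
      (∀ p, ((C.column (x + β.b + β.c)).kernelDiagram 0).obj p)) where
  carrier := {q | (∀ (p : ℤ) (hp : p ≤ 0),
      (C.column (x + β.b + β.c)).map p 0 hp (q.2.1 p).1 = C.kColumn x q.1) ∧
    ∀ p, ((C.column (x + β.b + β.c)).kernelInclusion 0 1 zero_le_one).app p (q.2.2 p) =
      ((C.column (x + β.b + β.c)).kernelDiagram 1).limDiff q.2.1 p}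
  zero_mem' := ⟨fun p hp => (map_zero _).trans (map_zero _).symm, fun p => by
    rw [Prod.snd_zero, Prod.fst_zero, map_zero]; exact map_zero _⟩
  add_mem' := by
    rintro ⟨z, y, u⟩ ⟨z', y', u'⟩ ⟨h₁, h₂⟩ ⟨h₁', h₂'⟩
    refine ⟨fun p hp => ?_, fun p => ?_⟩
    · exact (map_add _ _ _).trans
        ((congrArg₂ (· + ·) (h₁ p hp) (h₁' p hp)).trans (map_add _ _ _).symm)
    · refine (map_add _ _ _).trans ((congrArg₂ (· + ·) (h₂ p) (h₂' p)).trans ?_)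
      exact (congrFun (LinearMap.map_add (ZDiagram.limDiff _) y y') p).symm
  smul_mem' := by
    rintro r ⟨z, y, u⟩ ⟨h₁, h₂⟩
    refine ⟨fun p hp => ?_, fun p => ?_⟩
    · exact (map_smul _ _ _).trans ((congrArg (r • ·) (h₁ p hp)).trans (map_smul _ _ _).symm)
    · refine (map_smul _ _ _).trans ((congrArg (r • ·) (h₂ p)).trans ?_)
      exact (congrFun (LinearMap.map_smul (ZDiagram.limDiff _) r y) p).symm

theorem exists_mem_connectingRel (x : ℤ × ℤ) (z : C.cyclesInf (x + β.b)) :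
    ∃ y u, (z, y, u) ∈ C.connectingRel x := by
  have hy : ∀ p, ∃ y : ((C.column (x + β.b + β.c)).kernelDiagram 1).obj p, ∀ hp : p ≤ 0,
      (C.column (x + β.b + β.c)).map p 0 hp y.1 = C.kColumn x z := by
    intro p
    by_cases hp : p ≤ 0
    · obtain ⟨s, hs⟩ := C.exists_map_eq_kColumn x z p hp
      refine ⟨⟨s, ZDiagram.mem_ker_of_map_eq_zero _ (by omega) ?_⟩, fun _ => hs⟩
      rw [← ZDiagram.map_map _ p 0 1 hp zero_le_one, hs, map_zero_one_kColumn]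
    · exact ⟨0, fun h => absurd h hp⟩
  choose y hy using hy
  have hu : ∀ p, ∃ u : ((C.column (x + β.b + β.c)).kernelDiagram 0).obj p,
      ((C.column (x + β.b + β.c)).kernelInclusion 0 1 zero_le_one).app p u =
        ((C.column (x + β.b + β.c)).kernelDiagram 1).limDiff y p := by
    intro p
    refine ⟨⟨(((C.column (x + β.b + β.c)).kernelDiagram 1).limDiff y p).1, ?_⟩, rfl⟩
    by_cases hp : p ≤ 0
    · refine ZDiagram.mem_ker_of_map_eq_zero _ hp ?_
      -- Both y_p and i(y_{p-1}) lift k(z), so their difference dies in position 0.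
      rw [ZDiagram.val_limDiff_kernelDiagram, map_sub, ZDiagram.map_map, hy, hy, sub_self]
    -- For p ≥ 1 both terms vanish. This includes p = 1, where y_0 lies in the kernel of the step to
    -- position 1.
    · rw [ZDiagram.val_limDiff_kernelDiagram, ZDiagram.eq_zero_of_le _ 1 (by omega),
        ZDiagram.map_kernelDiagram_eq_zero _ 1 _ (by omega), sub_zero]
      exact zero_mem _
  choose u hu using hu
  exact ⟨y, u, hy, hu⟩

/-- If k(z) = 0, the lifts y already lie in the smaller tower, so u is a coboundary there. This
makes δ independent of z within its class and of the lifts. -/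
theorem mk_eq_zero_of_mem_connectingRel (x : ℤ × ℤ) {z : C.cyclesInf (x + β.b)}
    {y : ∀ p, ((C.column (x + β.b + β.c)).kernelDiagram 1).obj p}
    {u : ∀ p, ((C.column (x + β.b + β.c)).kernelDiagram 0).obj p}
    (h : (z, y, u) ∈ C.connectingRel x) (hz : (Submodule.Quotient.mk z : C.cyclesQuot x) = 0) :
    (Submodule.Quotient.mk u : C.lim1Ker (x + β.b + β.c)) = 0 := by
  rw [← kColumn_eq_zero_iff] at hz
  have hv : ∀ p, (y p).1 ∈ LinearMap.ker
      ((C.column (x + β.b + β.c)).map p (max p 0) (le_max_left p 0)) := by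
    intro p
    by_cases hp : p ≤ 0
    · exact ZDiagram.mem_ker_of_map_eq_zero _ hp ((h.1 p hp).trans hz)
    · rw [ZDiagram.eq_zero_of_le _ 1 (by omega) (y p)]
      exact zero_mem _
  refine (Submodule.Quotient.mk_eq_zero _).2 ⟨fun p => ⟨(y p).1, hv p⟩, ?_⟩
  funext p
  exact Subtype.ext (congrArg Subtype.val (h.2 p)).symm

/-- The map `(z, y, u) ↦ [z]`. -/
def connectingRelFst (x : ℤ × ℤ) : C.connectingRel x →ₗ[R] C.cyclesQuot x :=
  Submodule.mkQ _ ∘ₗ LinearMap.fst R _ _ ∘ₗ Submodule.subtype _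

/-- The map `(z, y, u) ↦ [u]`. -/
def connectingRelSnd (x : ℤ × ℤ) : C.connectingRel x →ₗ[R] C.lim1Ker (x + β.b + β.c) :=
  Submodule.mkQ _ ∘ₗ LinearMap.snd R _ _ ∘ₗ LinearMap.snd R _ _ ∘ₗ Submodule.subtype _

theorem connectingRelFst_surjective (x : ℤ × ℤ) :
    Function.Surjective (C.connectingRelFst x) := by
  intro q
  obtain ⟨z, rfl⟩ := Submodule.Quotient.mk_surjective _ q
  obtain ⟨y, u, h⟩ := C.exists_mem_connectingRel x z
  exact ⟨⟨_, h⟩, rfl⟩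

/-- The connecting homomorphism `δ`. -/
def connecting (x : ℤ × ℤ) : C.cyclesQuot x →ₗ[R] C.lim1Ker (x + β.b + β.c) :=
  LinearMap.relLift LinearMap.id (C.connectingRelFst x) (C.connectingRelSnd x)
    (C.connectingRelFst_surjective x) fun q hq => C.mk_eq_zero_of_mem_connectingRel x q.2 hq

theorem connecting_mk {x : ℤ × ℤ} {z : C.cyclesInf (x + β.b)}
    {y : ∀ p, ((C.column (x + β.b + β.c)).kernelDiagram 1).obj p}
    {u : ∀ p, ((C.column (x + β.b + β.c)).kernelDiagram 0).obj p}
    (h : (z, y, u) ∈ C.connectingRel x) :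
    C.connecting x (Submodule.Quotient.mk z) = Submodule.Quotient.mk u :=
  LinearMap.relLift_eq (z := (⟨_, h⟩ : C.connectingRel x)) rfl

/-- If u is the coboundary of v, then y - v is a compatible family through k(z), so k(z) comes from
the limit. Conversely, a compatible family through k(z) serves as y with u = 0. -/
theorem exact_limToCycles_connecting (x : ℤ × ℤ) :
    Function.Exact (C.limToCycles hβ x) (C.connecting x) := by
  intro q
  obtain ⟨z, rfl⟩ := Submodule.Quotient.mk_surjective _ q
  constructor
  · intro hq
    obtain ⟨y, u, h⟩ := C.exists_mem_connectingRel x z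
    rw [C.connecting_mk h, Submodule.Quotient.mk_eq_zero] at hq
    obtain ⟨v, rfl⟩ := hq
    have hs : (fun p => (y p).1 - (v p).1) ∈ (C.column (x + β.b + β.c)).lim := by
      rw [ZDiagram.mem_lim]
      intro p
      have := congrArg Subtype.val (h.2 p)
      change (v p).1 - (C.column (x + β.b + β.c)).map (p - 1) p (by omega) (v (p - 1)).1 =
        (y p).1 - (C.column (x + β.b + β.c)).map (p - 1) p (by omega) (y (p - 1)).1 at this
      rw [sub_eq_sub_iff_add_eq_add] at this
      rw [map_sub, sub_eq_sub_iff_add_eq_add]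
      exact (add_comm _ _).trans this
    obtain ⟨s, hs⟩ := C.exists_limMap_eq_of_mem_column_lim hβ _ _ hs 0 (β.det_add_zsmul 0 _)
    have h₀ := h.1 0 le_rfl
    rw [ZDiagram.map_self] at h₀
    -- The correction v vanishes in position 0, so the coordinate there is still k(z).
    rw [ZDiagram.eq_zero_of_le _ 0 le_rfl (v 0), sub_zero, h₀, C.kColumn_eq_iff hβ x _ z _ rfl] at hs
    exact (C.mk_mem_range_limToCycles_iff hβ x z).2 ⟨s, hs⟩
  · intro hq
    obtain ⟨s, hs⟩ := (C.mk_mem_range_limToCycles_iff hβ x z).1 hq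
    obtain ⟨s', hlim, h₀⟩ : ∃ s' : ∀ p, (C.column (x + β.b + β.c)).obj p,
        s' ∈ (C.column (x + β.b + β.c)).lim ∧ s' 0 = C.kColumn x z :=
      ⟨_, C.limMap_mem_column_lim hβ _ _ (fun p => β.det_add_zsmul p _) s,
        (C.kColumn_eq_iff hβ x _ z (β.det_add_zsmul 0 _) rfl s).2 hs⟩
    have hy : ∀ p, s' p ∈ LinearMap.ker
        ((C.column (x + β.b + β.c)).map p (max p 1) (le_max_left p 1)) := by
      intro p
      rw [LinearMap.mem_ker, ZDiagram.map_of_mem_lim _ hlim,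
        ← ZDiagram.map_of_mem_lim _ hlim 1 (max p 1) (le_max_right _ _),
        ← ZDiagram.map_of_mem_lim _ hlim 0 1 zero_le_one, h₀, map_zero_one_kColumn, map_zero]
    have h : (z, fun p => ⟨s' p, hy p⟩, 0) ∈ C.connectingRel x := by
      refine ⟨fun p hp => (ZDiagram.map_of_mem_lim _ hlim p 0 hp).trans h₀, fun p => ?_⟩
      exact (map_zero _).trans
        (Subtype.ext (sub_eq_zero.2 ((ZDiagram.mem_lim _).1 hlim p).symm).symm)
    rw [C.connecting_mk h]
    rfl

theorem lim1KerMap_mk (w : ℤ × ℤ) (u : ∀ p, ((C.column w).kernelDiagram 0).obj p) :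
    C.lim1KerMap w (Submodule.Quotient.mk u) = Submodule.Quotient.mk
      fun p => ((C.column w).kernelInclusion 0 1 zero_le_one).app p (u p) := rfl

/-- If u becomes the coboundary of y in the larger tower, then y is compatible up to elements that
die in position 0. So y_0 lies in Ker i and in every Im i^r, which makes it k(z) for an infinite
cycle z, and y is a system of lifts for z. -/
theorem exact_connecting_lim1KerMap (x : ℤ × ℤ) :
    Function.Exact (C.connecting x) (C.lim1KerMap (x + β.b + β.c)) := by
  intro q
  constructor
  · intro hq
    obtain ⟨u, rfl⟩ := Submodule.Quotient.mk_surjective _ q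
    rw [lim1KerMap_mk, Submodule.Quotient.mk_eq_zero] at hq
    obtain ⟨y, hy⟩ := hq
    have hu : ∀ p, (u p).1 =
        (y p).1 - (C.column (x + β.b + β.c)).map (p - 1) p (by omega) (y (p - 1)).1 :=
      fun p => (congrArg Subtype.val (congrFun hy p)).symm
    have hc : ∀ (p : ℤ) (hp : p ≤ 0),
        (C.column (x + β.b + β.c)).map p 0 hp (y p).1 = (y 0).1 := by
      intro p hp
      obtain ⟨n, hn⟩ : ∃ n : ℕ, p = -n := ⟨(-p).toNat, by omega⟩
      induction n generalizing p with
      | zero => exact ZDiagram.map_eq_of_eq _ (s := fun p => (y p).1) (by omega) hp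
      | succ n ih =>
        -- Pushing the coboundary equation in position p + 1 forward to position 0 kills u and
        -- leaves equality of the images of y_{p+1} and y_p.
        have h := congrArg ((C.column (x + β.b + β.c)).map (p + 1) 0 (by omega)) (hu (p + 1))
        rw [ZDiagram.map_kernelDiagram_eq_zero _ 0 _ le_rfl, map_sub, ih (p + 1) (by omega)
          (by omega), ZDiagram.map_map] at h
        have key : ∀ q (_ : q = p) (hq : q ≤ 0),
            (C.column (x + β.b + β.c)).map p 0 hp (y p).1 =
              (C.column (x + β.b + β.c)).map q 0 hq (y q).1 := by
          rintro _ rfl _; rfl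
        rw [key (p + 1 - 1) (by omega) (by omega)]
        exact (sub_eq_zero.1 h.symm).symm
    obtain ⟨z, hz⟩ := C.exists_kColumn_eq x (y 0).1 (fun p hp => ⟨_, hc p hp⟩)
      (ZDiagram.map_kernelDiagram_eq_zero _ 1 _ le_rfl _)
    refine ⟨Submodule.Quotient.mk z, C.connecting_mk (y := y) ⟨fun p hp => ?_, fun p => ?_⟩⟩
    · rw [hc p hp, hz]
    · exact (congrFun hy p).symm
  · rintro ⟨q, rfl⟩
    obtain ⟨z, rfl⟩ := Submodule.Quotient.mk_surjective _ q
    obtain ⟨y, u, h⟩ := C.exists_mem_connectingRel x z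
    rw [C.connecting_mk h, lim1KerMap_mk, Submodule.Quotient.mk_eq_zero]
    exact ⟨y, funext fun p => (h.2 p).symm⟩

/-- The two diagrams of the extension theorem. -/
def eInfinityExtension (x : ℤ × ℤ) : C.EInfinityExtension hβ x where
  colimStagePrev_le := C.colimStagePrev_le hβ x
  limStage_le := C.limStage_le hβ _
  boundariesStable_le := C.boundariesStable_le hβ _
  boundariesInf_le := C.boundariesInf_le _
  rangeJ_le := C.rangeJ_le x
  cyclesStable_le := C.cyclesStable_le hβ _
  topIncl := C.topIncl hβ x
  topProj := C.topProj hβ x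
  topIncl_injective := C.topIncl_injective hβ x
  top_exact := C.top_exact hβ x
  topProj_surjective := C.topProj_surjective hβ x
  botIncl := C.botIncl hβ x
  botProj := C.botProj x
  botIncl_injective := C.botIncl_injective hβ x
  bot_exact := C.bot_exact hβ x
  botProj_surjective := C.botProj_surjective x
  mid := C.stableToInf hβ _
  M := C.limQuotToCycles hβ x
  mid_injective := C.stableToInf_injective hβ _
  M_injective := C.limQuotToCycles_injective hβ x
  comm_left := LinearMap.ext (C.stableToInf_topIncl hβ x)
  comm_right := LinearMap.ext fun e => (C.limQuotToCycles_topProj hβ x e).symm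
  pullback := C.exists_pullback hβ x
  t := C.limToCycles hβ x
  δ := C.connecting x
  exact_t s := (C.limToCycles_eq_zero_iff hβ x s).trans
    ⟨fun h => ⟨⟨s.1, h⟩, rfl⟩, by rintro ⟨s, rfl⟩; exact s.2⟩
  exact_δ := C.exact_limToCycles_connecting hβ x
  exact_lim1 := C.exact_connecting_lim1KerMap x
  t_eq := rfl
  mid_mk _ := rfl
  botProj_mk _ := rfl
  botIncl_mk s := C.botIncl_toColimQuot hβ x s
  t_apply _ _ h := C.limToCycles_apply hβ h.symm
  δ_mk _ _ _ h₁ h₂ := C.connecting_mk ⟨h₁, h₂⟩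

end ExactCouple

namespace ExactCouple

variable {R : Type u} [Ring R] {β : Bidegrees} (hβ : β.Regular)
  {C C' C'' : ExactCouple.{u, v} R β}

/-! #### Induced maps -/

theorem Hom.f_transport (φ : Hom C C') {x y : ℤ × ℤ} (h : x = y) (s : C.D x) :
    φ.f y (C.transport h s) = C'.transport h (φ.f x s) := by
  subst h; rfl

/-- The morphism `D(n) → D'(n)` induced by a morphism of exact couples. -/
def Hom.diagram (φ : Hom C C') (n : ℤ) : ZDiagram.Hom (C.diagram n) (C'.diagram n) :=
  φ.column (β.basePoint n)

theorem Hom.f_limMap (φ : Hom C C') (n : ℤ) (x : ℤ × ℤ) (hx : det₂ β.a x = n)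
    (s : (C.diagram n).lim) :
    φ.f x (C.limMap hβ n x hx s) = C'.limMap hβ n x hx ((φ.diagram n).limMap s) :=
  φ.f_transport _ _

theorem Hom.colimMap_colimMap (φ : Hom C C') (n : ℤ) (x : ℤ × ℤ) (hx : det₂ β.a x = n)
    (s : C.D x) :
    (φ.diagram n).colimMap (C.colimMap hβ n x hx s) = C'.colimMap hβ n x hx (φ.f x s) :=
  ((φ.diagram n).colimMap_toColim _ _).trans
    (congrArg ((C'.diagram n).toColim (β.pos x)) (φ.f_transport _ s))

theorem Hom.colimFiltration_le (φ : Hom C C') (n : ℤ) (x : ℤ × ℤ) (hx : det₂ β.a x = n) :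
    C.colimFiltration hβ n x hx ≤
      (C'.colimFiltration hβ n x hx).comap (φ.diagram n).colimMap := by
  rintro _ ⟨s, rfl⟩
  exact ⟨φ.f x s, (φ.colimMap_colimMap hβ n x hx s).symm⟩

theorem Hom.limFiltration_le (φ : Hom C C') (n : ℤ) (x : ℤ × ℤ) (hx : det₂ β.a x = n) :
    C.limFiltration hβ n x hx ≤
      (C'.limFiltration hβ n x hx).comap (φ.diagram n).limMap := by
  intro s hs
  refine LinearMap.mem_ker.2 ?_
  rw [← φ.f_limMap hβ n x hx, LinearMap.mem_ker.1 hs, map_zero]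

theorem Hom.cyclesStable_le (hβ : β.Regular) (φ : Hom C C') (y : ℤ × ℤ) :
    C.cyclesStable y ≤ (C'.cyclesStable y).comap (φ.g y) := by
  intro e he
  obtain ⟨s, hs⟩ := (C.mem_cyclesStable hβ _ y _ rfl rfl e).1 he
  refine (C'.mem_cyclesStable hβ _ y _ rfl rfl _).2 ⟨(φ.diagram _).limMap s, ?_⟩
  rw [← φ.f_limMap, hs, φ.comm_k]

theorem Hom.cyclesInf_le (φ : Hom C C') (y : ℤ × ℤ) :
    C.cyclesInf y ≤ (C'.cyclesInf y).comap (φ.g y) := by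
  intro e he
  refine C'.mem_cyclesInf.2 fun r => ?_
  obtain ⟨s, hs⟩ := (C.mem_cyclesFin r y _ _ rfl (sub_add_cancel _ _) e).1 (C.mem_cyclesInf.1 he r)
  refine (C'.mem_cyclesFin r y _ _ rfl (sub_add_cancel _ _) _).2 ⟨φ.f _ s, ?_⟩
  rw [← hom_iter, hs, φ.comm_k]

theorem Hom.boundariesInf_le (φ : Hom C C') (y : ℤ × ℤ) :
    C.boundariesInf y ≤ (C'.boundariesInf y).comap (φ.g y) := by
  intro e he
  obtain ⟨r, hr⟩ := C.mem_boundariesInf.1 he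
  obtain ⟨s, hs, rfl⟩ := (C.mem_boundariesFin r y _ _ (sub_add_cancel _ _) rfl e).1 hr
  refine C'.mem_boundariesInf.2 ⟨r, (C'.mem_boundariesFin r y _ _ (sub_add_cancel _ _) rfl _).2
    ⟨φ.f _ s, ?_, (φ.comm_j _ _ _ _).symm⟩⟩
  rw [← hom_iter, hs, map_zero]

theorem Hom.boundariesStable_le (hβ : β.Regular) (φ : Hom C C') (y : ℤ × ℤ) :
    C.boundariesStable y ≤ (C'.boundariesStable y).comap (φ.g y) := by
  rw [C.boundariesStable_eq hβ, C'.boundariesStable_eq hβ]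
  exact φ.boundariesInf_le y

theorem Hom.rangeJ_le (φ : Hom C C') (x : ℤ × ℤ) :
    C.rangeJ x ≤ (C'.rangeJ x).comap (φ.g (x + β.b)) := by
  rintro _ ⟨s, rfl⟩
  exact ⟨φ.f x s, (φ.comm_j _ _ _ _).symm⟩

/-- The maps which a morphism of exact couples induces on the objects of the two diagrams. -/
def Hom.inducedMaps (φ : Hom C C') (x : ℤ × ℤ) : InducedMaps hβ φ x where
  colimQuot := Submodule.mapQ _ _ ((φ.diagram _).colimMap.restrict (φ.colimFiltration_le hβ _ x rfl))
    fun _ h => φ.colimFiltration_le hβ _ (x - β.a) _ h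
  limStage := (φ.diagram _).limMap.restrict (φ.limFiltration_le hβ _ _ _)
  limStageNext := (φ.diagram _).limMap.restrict (φ.limFiltration_le hβ _ _ _)
  limQuot := Submodule.mapQ _ _ ((φ.diagram _).limMap.restrict (φ.limFiltration_le hβ _ _ _))
    fun _ h => φ.limFiltration_le hβ _ (x + β.b + β.c) _ h
  eStable := Submodule.mapQ _ _ ((φ.g _).restrict (φ.cyclesStable_le hβ _))
    fun _ h => φ.boundariesStable_le hβ _ h
  eInf := Submodule.mapQ _ _ ((φ.g _).restrict (φ.cyclesInf_le _))
    fun _ h => φ.boundariesInf_le _ h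
  cyclesQuot := Submodule.mapQ _ _ ((φ.g _).restrict (φ.cyclesInf_le _))
    fun _ h => φ.rangeJ_le _ h
  cyclesStable_le := φ.cyclesStable_le hβ _
  cyclesInf_le := φ.cyclesInf_le _
  colimQuot_mk s := congrArg Submodule.Quotient.mk
    (Subtype.ext (φ.colimMap_colimMap hβ _ x rfl s))
  limStage_apply _ _ := rfl
  limStageNext_apply _ _ := rfl
  limQuot_mk _ := rfl
  eStable_mk _ := rfl
  eInf_mk _ := rfl
  cyclesQuot_mk _ := rfl

/-! ### Naturality, identities and composition for arbitrary induced maps -/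

variable {hβ}

theorem InducedMaps.botIncl_comm {φ : Hom C C'} {x : ℤ × ℤ} (F : InducedMaps hβ φ x)
    (S : C.EInfinityExtension hβ x) (S' : C'.EInfinityExtension hβ x) (q : C.colimQuot hβ x) :
    F.eInf (S.botIncl q) = S'.botIncl (F.colimQuot q) := by
  obtain ⟨s, rfl⟩ := C.toColimQuot_surjective hβ x q
  refine (congrArg F.eInf (S.botIncl_mk s)).trans ((F.eInf_mk _).trans ?_)
  refine Eq.trans ?_ ((congrArg S'.botIncl (F.colimQuot_mk s)).trans (S'.botIncl_mk _)).symm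
  exact congrArg Submodule.Quotient.mk (Subtype.ext (φ.comm_j _ _ _ s))

theorem InducedMaps.mid_comm {φ : Hom C C'} {x : ℤ × ℤ} (F : InducedMaps hβ φ x)
    (S : C.EInfinityExtension hβ x) (S' : C'.EInfinityExtension hβ x) (e : C.eStable (x + β.b)) :
    F.eInf (S.mid e) = S'.mid (F.eStable e) := by
  obtain ⟨z, rfl⟩ := Submodule.Quotient.mk_surjective _ e
  rw [S.mid_mk, F.eInf_mk, F.eStable_mk, S'.mid_mk]
  rfl

theorem InducedMaps.botProj_comm {φ : Hom C C'} {x : ℤ × ℤ} (F : InducedMaps hβ φ x)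
    (S : C.EInfinityExtension hβ x) (S' : C'.EInfinityExtension hβ x) (e : C.eInf (x + β.b)) :
    F.cyclesQuot (S.botProj e) = S'.botProj (F.eInf e) := by
  obtain ⟨z, rfl⟩ := Submodule.Quotient.mk_surjective _ e
  rw [S.botProj_mk, F.eInf_mk, F.cyclesQuot_mk, S'.botProj_mk]

theorem InducedMaps.t_comm {φ : Hom C C'} {x : ℤ × ℤ} (F : InducedMaps hβ φ x)
    (S : C.EInfinityExtension hβ x) (S' : C'.EInfinityExtension hβ x)
    (s : C.limStageNext hβ (x + β.b + β.c)) :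
    F.cyclesQuot (S.t s) = S'.t (F.limStageNext s) := by
  obtain ⟨z, hz⟩ := C.limMapNext_mem_range hβ x s
  rw [S.t_apply s z hz, F.cyclesQuot_mk]
  refine (S'.t_apply _ _ ?_).symm
  have h : (F.limStageNext s).1 = (φ.diagram _).limMap s.1 :=
    Subtype.ext (funext fun p => F.limStageNext_apply s p)
  rw [h, ← φ.f_limMap, ← φ.comm_k]
  exact congrArg (φ.f _) hz

/-- The projection onto L^{w+a}/L^w is surjective and t factors through it as M, so naturality of t
suffices. -/
theorem InducedMaps.M_comm {φ : Hom C C'} {x : ℤ × ℤ} (F : InducedMaps hβ φ x)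
    (S : C.EInfinityExtension hβ x) (S' : C'.EInfinityExtension hβ x)
    (l : C.limQuot hβ (x + β.b + β.c)) : F.cyclesQuot (S.M l) = S'.M (F.limQuot l) := by
  obtain ⟨s, rfl⟩ := Submodule.Quotient.mk_surjective _ l
  have h := F.t_comm S S' s
  rw [F.limQuot_mk]
  rw [S.t_eq, S'.t_eq] at h
  exact h

/-- A morphism of exact couples carries a connecting triple (z, y, u) to a connecting triple. -/
theorem InducedMaps.δ_comm {φ : Hom C C'} {x : ℤ × ℤ} (F : InducedMaps hβ φ x)
    (S : C.EInfinityExtension hβ x) (S' : C'.EInfinityExtension hβ x) (q : C.cyclesQuot x) :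
    φ.lim1Ker _ (S.δ q) = S'.δ (F.cyclesQuot q) := by
  obtain ⟨z, rfl⟩ := Submodule.Quotient.mk_surjective _ q
  obtain ⟨y, u, hy, hu⟩ := C.exists_mem_connectingRel x z
  rw [S.δ_mk z y u hy hu, F.cyclesQuot_mk]
  refine (S'.δ_mk _ (fun p => ((φ.column _).kernelMap 1).app p (y p))
    (fun p => ((φ.column _).kernelMap 0).app p (u p)) (fun p hp => ?_) (fun p => ?_)).symm
  · refine ((φ.column _).naturality p 0 hp _).symm.trans ?_
    exact (congrArg (φ.f _) (hy p hp)).trans (φ.comm_k _ _ _ _)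
  · have h := congrArg (((φ.column _).kernelMap 1).app p) (hu p)
    rw [ZDiagram.limDiff_apply, map_sub, ZDiagram.Hom.naturality] at h
    exact h

/-- The maps of the top row have no recorded formula on representatives. Their naturality is deduced
from the bottom row by cancelling the injections `S'.mid` and `S'.M`. -/
theorem InducedMaps.commutes {φ : Hom C C'} {x : ℤ × ℤ} (F : InducedMaps hβ φ x)
    (S : C.EInfinityExtension hβ x) (S' : C'.EInfinityExtension hβ x) : F.Commutes S S' where
  topIncl := LinearMap.ext fun q => S'.mid_injective <| by
    have h := LinearMap.congr_fun S.comm_left q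
    have h' := LinearMap.congr_fun S'.comm_left (F.colimQuot q)
    rw [LinearMap.comp_apply] at h h'
    rw [LinearMap.comp_apply, LinearMap.comp_apply, ← F.mid_comm S S', h, h', F.botIncl_comm S S']
  topProj := LinearMap.ext fun e => S'.M_injective <| by
    have h := LinearMap.congr_fun S.comm_right e
    have h' := LinearMap.congr_fun S'.comm_right (F.eStable e)
    rw [LinearMap.comp_apply, LinearMap.comp_apply] at h h'
    rw [LinearMap.comp_apply, LinearMap.comp_apply, ← F.M_comm S S', ← h, ← h', ← F.mid_comm S S',
      F.botProj_comm S S']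
  botIncl := LinearMap.ext (F.botIncl_comm S S')
  botProj := LinearMap.ext (F.botProj_comm S S')
  mid := LinearMap.ext (F.mid_comm S S')
  M := LinearMap.ext (F.M_comm S S')
  incl := LinearMap.ext fun s => Subtype.ext (Subtype.ext (funext fun p =>
    (F.limStageNext_apply _ p).trans (F.limStage_apply s p).symm))
  t := LinearMap.ext (F.t_comm S S')
  δ := LinearMap.ext (F.δ_comm S S')
  lim1 := LinearMap.ext fun q => by
    obtain ⟨u, rfl⟩ := Submodule.Quotient.mk_surjective _ q
    rfl

theorem InducedMaps.isId {x : ℤ × ℤ} (F : InducedMaps hβ (Hom.id C) x) : F.IsId where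
  colimQuot := LinearMap.ext fun q => by
    obtain ⟨s, rfl⟩ := C.toColimQuot_surjective hβ x q
    exact F.colimQuot_mk s
  limStage := LinearMap.ext fun s =>
    Subtype.ext (Subtype.ext (funext fun p => F.limStage_apply s p))
  limStageNext := LinearMap.ext fun s =>
    Subtype.ext (Subtype.ext (funext fun p => F.limStageNext_apply s p))
  limQuot := LinearMap.ext fun l => by
    obtain ⟨s, rfl⟩ := Submodule.Quotient.mk_surjective _ l
    exact (F.limQuot_mk s).trans (congrArg Submodule.Quotient.mk
      (Subtype.ext (Subtype.ext (funext fun p => F.limStageNext_apply s p))))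
  eStable := LinearMap.ext fun e => by
    obtain ⟨z, rfl⟩ := Submodule.Quotient.mk_surjective _ e
    exact F.eStable_mk z
  eInf := LinearMap.ext fun e => by
    obtain ⟨z, rfl⟩ := Submodule.Quotient.mk_surjective _ e
    exact F.eInf_mk z
  cyclesQuot := LinearMap.ext fun e => by
    obtain ⟨z, rfl⟩ := Submodule.Quotient.mk_surjective _ e
    exact F.cyclesQuot_mk z
  lim1Ker := LinearMap.ext fun q => by
    obtain ⟨u, rfl⟩ := Submodule.Quotient.mk_surjective _ q
    rfl
  lim1KerNext := LinearMap.ext fun q => by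
    obtain ⟨u, rfl⟩ := Submodule.Quotient.mk_surjective _ q
    rfl

theorem InducedMaps.isComp {φ : Hom C C'} {ψ : Hom C' C''} {x : ℤ × ℤ} (F : InducedMaps hβ φ x)
    (G : InducedMaps hβ ψ x) (H : InducedMaps hβ (φ.comp ψ) x) : F.IsComp G H where
  colimQuot := LinearMap.ext fun q => by
    obtain ⟨s, rfl⟩ := C.toColimQuot_surjective hβ x q
    exact (H.colimQuot_mk s).trans
      ((congrArg G.colimQuot (F.colimQuot_mk s)).trans (G.colimQuot_mk _)).symm
  limStage := LinearMap.ext fun s => Subtype.ext (Subtype.ext (funext fun p =>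
    (H.limStage_apply s p).trans
      ((G.limStage_apply _ p).trans (congrArg (ψ.f _) (F.limStage_apply s p))).symm))
  limStageNext := LinearMap.ext fun s => Subtype.ext (Subtype.ext (funext fun p =>
    (H.limStageNext_apply s p).trans
      ((G.limStageNext_apply _ p).trans (congrArg (ψ.f _) (F.limStageNext_apply s p))).symm))
  limQuot := LinearMap.ext fun l => by
    obtain ⟨s, rfl⟩ := Submodule.Quotient.mk_surjective _ l
    rw [LinearMap.comp_apply, H.limQuot_mk, F.limQuot_mk, G.limQuot_mk]
    exact congrArg Submodule.Quotient.mk (Subtype.ext (Subtype.ext (funext fun p =>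
      (H.limStageNext_apply s p).trans
        ((G.limStageNext_apply _ p).trans (congrArg (ψ.f _) (F.limStageNext_apply s p))).symm)))
  eStable := LinearMap.ext fun e => by
    obtain ⟨z, rfl⟩ := Submodule.Quotient.mk_surjective _ e
    rw [LinearMap.comp_apply, H.eStable_mk, F.eStable_mk, G.eStable_mk]
    rfl
  eInf := LinearMap.ext fun e => by
    obtain ⟨z, rfl⟩ := Submodule.Quotient.mk_surjective _ e
    rw [LinearMap.comp_apply, H.eInf_mk, F.eInf_mk, G.eInf_mk]
    rfl
  cyclesQuot := LinearMap.ext fun e => by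
    obtain ⟨z, rfl⟩ := Submodule.Quotient.mk_surjective _ e
    rw [LinearMap.comp_apply, H.cyclesQuot_mk, F.cyclesQuot_mk, G.cyclesQuot_mk]
    rfl
  lim1Ker := LinearMap.ext fun q => by
    obtain ⟨u, rfl⟩ := Submodule.Quotient.mk_surjective _ q
    rfl
  lim1KerNext := LinearMap.ext fun q => by
    obtain ⟨u, rfl⟩ := Submodule.Quotient.mk_surjective _ q
    rfl

end ExactCouple

end

/-! ### The theorem -/

theorem mainTheorem1 {R : Type u} [Ring R] {β : Bidegrees} (hβ : β.Regular) :
    (∀ C : ExactCouple.{u, v} R β, ∃ α, C.IsStable α) ∧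
    ∃ (S : ∀ (C : ExactCouple.{u, v} R β) (x : ℤ × ℤ), C.EInfinityExtension hβ x)
      (F : ∀ (C C' : ExactCouple.{u, v} R β) (φ : C.Hom C') (x : ℤ × ℤ),
        ExactCouple.InducedMaps hβ φ x),
      (∀ C C' φ x, (F C C' φ x).Commutes (S C x) (S C' x)) ∧
      (∀ C x, (F C C (ExactCouple.Hom.id C) x).IsId) ∧
      (∀ C C' C'' φ ψ x, (F C C' φ x).IsComp (F C' C'' ψ x) (F C C'' (φ.comp ψ) x)) := by
  refine ⟨fun C => C.exists_isStable hβ, fun C x => C.eInfinityExtension hβ x,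
    fun C C' φ x => φ.inducedMaps hβ x, ?_, ?_, ?_⟩
  · exact fun C C' φ x => (φ.inducedMaps hβ x).commutes _ _
  · exact fun C x => ((ExactCouple.Hom.id C).inducedMaps hβ x).isId
  · exact fun C C' C'' φ ψ x =>
      (φ.inducedMaps hβ x).isComp (ψ.inducedMaps hβ x) ((φ.comp ψ).inducedMaps hβ x)
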